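/- Let $T>0$ and $\Omega=[0,1]\times[0,T]$, with points $(x,t)$. Derivatives at boundary points of $\Omega$ are one-sided. Call $f:\Omega\to\mathbb R$ *completely continuous* (absolutely continuous in the sense of Carathéodory) if there are a constant $c$ and integrable functions $g$ on $[0,1]$, $h$ on $[0,T]$, $k$ on $\Omega$ with $$f(x,t)=c+\int_0^x g(y)\,dy+\int_0^t h(s)\,ds+\int_0^x\!\int_0^t k(y,s)\,ds\,dy\qquad((x,t)\in\Omega);$$ then $g=\frac{\partial f}{\partial x}(\cdot,0)$, $h=\frac{\partial f}{\partial t}(0,\cdot)$ and $k=\frac{\partial^2 f}{\partial x\,\partial t}$ almost everywhere. Let $\mathcal A(\Omega)$ be the set of completely continuous $f$ for which these three derivatives are square integrable. Let $W(\Omega)$ be the space of all $u:\Omega\to\mathbb R$ whose derivative $\frac{\partial^4u}{\partial x^2\partial t^2}=\frac{\partial^2}{\partial x^2}\frac{\partial^2}{\partial t^2}u$ exists everywhere on $\Omega$ and belongs to $\mathcal A(\Omega)$, and which satisfy $u(x,0)=\frac{\partial u}{\partial t}(x,0)=0$ for $x\in[0,1]$ and $u(0,t)=u(1,t)=0$ for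 $t\in[0,T]$. Its inner product is $$\langle u,g\rangle_W=\sum_{i=0}^{2}\int_0^T\frac{\partial^3}{\partial t^3}\frac{\partial^i u}{\partial x^i}(0,t)\,\frac{\partial^3}{\partial t^3}\frac{\partial^i g}{\partial x^i}(0,t)\,dt+\sum_{j=0}^{2}\Big\langle \frac{\partial^j u}{\partial t^j}(\cdot,0),\frac{\partial^j g}{\partial t^j}(\cdot,0)\Big\rangle_{W_2^3}+\int_0^1\!\int_0^T\frac{\partial^3}{\partial x^3}\frac{\partial^3u}{\partial t^3}\,\frac{\partial^3}{\partial x^3}\frac{\partial^3g}{\partial t^3}\,dt\,dx,$$ where $\langle p,q\rangle_{W_2^3}=p(0)q(0)+p'(0)q'(0)+p'(1)q'(1)+\int_0^1p'''(x)q'''(x)\,dx$. Let $\widehat W(\Omega)=\mathcal A(\Omega)$, with the inner product $$\langle v,g\rangle_{\widehat W}=\int_0^T\frac{\partial v}{\partial t}(0,t)\frac{\partial g}{\partial t}(0,t)\,dt+v(0,0)g(0,0)+\int_0^1\frac{\partial v}{\partial x}(x,0)\frac{\partial g}{\partial x}(x,0)\,dx+\int_0^1\!\int_0^T\frac{\partial^2v}{\partial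 x\,\partial t}\frac{\partial^2g}{\partial x\,\partial t}\,dt\,dx.$$ Put $\|u\|_W=\sqrt{\langle u,u\rangle_W}$ and $\|v\|_{\widehat W}=\sqrt{\langle v,v\rangle_{\widehat W}}$. **Lemma 3.1.** For every $u\in W(\Omega)$ the derivatives $\frac{\partial^2u}{\partial t^2}$ and $\frac{\partial^2u}{\partial x^2}$ exist everywhere on $\Omega$, and $$Lu=\frac{\partial^2u}{\partial t^2}-\frac{\partial^2u}{\partial x^2}$$ defines a bounded linear operator $L:W(\Omega)\to\widehat W(\Omega)$: it maps $W(\Omega)$ linearly into $\widehat W(\Omega)$, and there is a constant $C$ (depending only on $T$) with $\|Lu\|_{\widehat W}\le C\,\|u\|_W$ for all $u\in W(\Omega)$. -/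

import Mathlib

open Set MeasureTheory

noncomputable section

namespace SineGordon

/-- The rectangle `Ω = [0,1] × [0,T]`; its points are pairs `(x, t)`. A function on `Ω` is
represented by the function `ℝ × ℝ → ℝ` that extends it by zero outside `Ω`. -/
def rect (T : ℝ) : Set (ℝ × ℝ) := Icc 0 1 ×ˢ Icc 0 T

/-- The partial derivative `∂/∂x` on `Ω` (one-sided at `x = 0` and `x = 1`). -/
def dx (u : ℝ × ℝ → ℝ) (p : ℝ × ℝ) : ℝ :=
  derivWithin (fun y => u (y, p.2)) (Icc 0 1) p.1

/-- The partial derivative `∂/∂t` on `Ω` (one-sided at `t = 0` and `t = T`). -/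
def dt (T : ℝ) (u : ℝ × ℝ → ℝ) (p : ℝ × ℝ) : ℝ :=
  derivWithin (fun s => u (p.1, s)) (Icc 0 T) p.2

/-- `u` is differentiable with respect to `x` at every point of `Ω`. -/
def DiffX (T : ℝ) (u : ℝ × ℝ → ℝ) : Prop :=
  ∀ p ∈ rect T, DifferentiableWithinAt ℝ (fun y => u (y, p.2)) (Icc 0 1) p.1

/-- `u` is differentiable with respect to `t` at every point of `Ω`. -/
def DiffT (T : ℝ) (u : ℝ × ℝ → ℝ) : Prop :=
  ∀ p ∈ rect T, DifferentiableWithinAt ℝ (fun s => u (p.1, s)) (Icc 0 T) p.2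

/-- `f` is absolutely ("completely") continuous on `Ω` as a function of two variables, in the
sense of Carathéodory:
`f(x,t) = c + ∫₀ˣ g + ∫₀ᵗ h + ∫₀ˣ ∫₀ᵗ k` on `Ω`, with `g`, `h`, `k` integrable.
Then, almost everywhere, `g = ∂f/∂x (·, 0)`, `h = ∂f/∂t (0, ·)` and `k = ∂²f/∂x∂t`. -/
structure HasDensities (T : ℝ) (f : ℝ × ℝ → ℝ) (c : ℝ) (g h : ℝ → ℝ) (k : ℝ × ℝ → ℝ) :
    Prop where
  integrable_x : IntegrableOn g (Icc 0 1)
  integrable_t : IntegrableOn h (Icc 0 T)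
  integrable_xt : IntegrableOn k (rect T)
  eq_on : ∀ x ∈ Icc (0 : ℝ) 1, ∀ t ∈ Icc (0 : ℝ) T,
    f (x, t) = c + (∫ y in (0 : ℝ)..x, g y) + (∫ s in (0 : ℝ)..t, h s)
      + ∫ y in (0 : ℝ)..x, ∫ s in (0 : ℝ)..t, k (y, s)

/-- `f` is absolutely continuous on `Ω`, its mixed derivative `∂²f/∂x∂t` lies in `L²(Ω)`, and
the edge derivatives `∂f/∂x (·, 0)` and `∂f/∂t (0, ·)` are square integrable. -/
def IsACL2 (T : ℝ) (f : ℝ × ℝ → ℝ) : Prop :=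
  ∃ (c : ℝ) (g h : ℝ → ℝ) (k : ℝ × ℝ → ℝ), HasDensities T f c g h k ∧
    MemLp g 2 (volume.restrict (Icc 0 1)) ∧
    MemLp h 2 (volume.restrict (Icc 0 T)) ∧
    MemLp k 2 (volume.restrict (rect T))

/-- Membership in the space `W(Ω)`. -/
structure MemW (T : ℝ) (u : ℝ × ℝ → ℝ) : Prop where
  zero_off : ∀ p ∉ rect T, u p = 0
  diff_t : DiffT T u
  diff_tt : DiffT T (dt T u)
  diff_xtt : DiffX T (dt T (dt T u))
  diff_xxtt : DiffX T (dx (dt T (dt T u)))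
  ac_xxtt : IsACL2 T (dx (dx (dt T (dt T u))))
  initial : ∀ x ∈ Icc (0 : ℝ) 1, u (x, 0) = 0
  initial_t : ∀ x ∈ Icc (0 : ℝ) 1, dt T u (x, 0) = 0
  left : ∀ t ∈ Icc (0 : ℝ) T, u (0, t) = 0
  right : ∀ t ∈ Icc (0 : ℝ) T, u (1, t) = 0

/-- Membership in the space `Ŵ(Ω)`. -/
structure MemWHat (T : ℝ) (v : ℝ × ℝ → ℝ) : Prop where
  zero_off : ∀ p ∉ rect T, v p = 0
  ac : IsACL2 T v

/-! Both spaces are closed under linear combinations. -/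

theorem IsACL2.congr {T : ℝ} {f f' : ℝ × ℝ → ℝ} (hf : IsACL2 T f)
    (h : ∀ p ∈ rect T, f' p = f p) : IsACL2 T f' := by
  obtain ⟨c, g, e, k, H, hg, he, hk⟩ := hf
  refine ⟨c, g, e, k, ⟨H.1, H.2, H.3, fun x hx t ht => ?_⟩, hg, he, hk⟩
  rw [h (x, t) ⟨hx, ht⟩, H.eq_on x hx t ht]

theorem isACL2_zero (T : ℝ) : IsACL2 T (fun _ => 0) :=
  ⟨0, 0, 0, 0, ⟨integrableOn_zero, integrableOn_zero, integrableOn_zero, by simp⟩,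
    MemLp.zero, MemLp.zero, MemLp.zero⟩

theorem IsACL2.smul {T : ℝ} {f : ℝ × ℝ → ℝ} (hf : IsACL2 T f) (a : ℝ) :
    IsACL2 T (a • f) := by
  obtain ⟨c, g, e, k, H, hg, he, hk⟩ := hf
  refine ⟨a * c, a • g, a • e, a • k,
    ⟨H.1.smul a, H.2.smul a, H.3.smul a, fun x hx t ht => ?_⟩,
    hg.const_smul a, he.const_smul a, hk.const_smul a⟩
  simp only [Pi.smul_apply, smul_eq_mul, intervalIntegral.integral_const_mul]
  rw [H.eq_on x hx t ht]
  ring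

theorem IsACL2.add {T : ℝ} {f f' : ℝ × ℝ → ℝ} (hf : IsACL2 T f) (hf' : IsACL2 T f') :
    IsACL2 T (f + f') := by
  obtain ⟨c, g, e, k, H, hg, he, hk⟩ := hf
  obtain ⟨c', g', e', k', H', hg', he', hk'⟩ := hf'
  refine ⟨c + c', g + g', e + e', k + k',
    ⟨H.1.add H'.1, H.2.add H'.2, H.3.add H'.3, fun x hx t ht => ?_⟩,
    hg.add hg', he.add he', hk.add hk'⟩
  have sx : Ioc 0 x ⊆ Icc (0 : ℝ) 1 := fun y hy => ⟨hy.1.le, hy.2.trans hx.2⟩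
  have st : Ioc 0 t ⊆ Icc (0 : ℝ) T := fun y hy => ⟨hy.1.le, hy.2.trans ht.2⟩
  have ix : ∀ {q : ℝ → ℝ}, IntegrableOn q (Icc 0 1) → IntervalIntegrable q volume 0 x :=
    fun hq => (intervalIntegrable_iff_integrableOn_Ioc_of_le hx.1).2 (hq.mono_set sx)
  have it : ∀ {q : ℝ → ℝ}, IntegrableOn q (Icc 0 T) → IntervalIntegrable q volume 0 t :=
    fun hq => (intervalIntegrable_iff_integrableOn_Ioc_of_le ht.1).2 (hq.mono_set st)
  have key : ∀ {q : ℝ × ℝ → ℝ}, IntegrableOn q (rect T) →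
      Integrable q ((volume.restrict (Ioc 0 x)).prod (volume.restrict (Ioc 0 t))) := by
    intro q hq
    rw [Measure.prod_restrict]
    exact hq.mono_set (prod_mono sx st)
  have kk := integral_add (key H.3).integral_prod_left (key H'.3).integral_prod_left
  have ka : (∫ y in (0 : ℝ)..x, ∫ s in (0 : ℝ)..t, (k + k') (y, s))
      = (∫ y in (0 : ℝ)..x, ∫ s in (0 : ℝ)..t, k (y, s))
        + ∫ y in (0 : ℝ)..x, ∫ s in (0 : ℝ)..t, k' (y, s) := by
    simp only [intervalIntegral.integral_of_le hx.1, intervalIntegral.integral_of_le ht.1]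
    rw [← kk]
    refine integral_congr_ae ?_
    filter_upwards [(key H.3).prod_right_ae, (key H'.3).prod_right_ae] with y h1 h2
    exact integral_add h1 h2
  rw [ka]
  simp only [Pi.add_apply]
  rw [intervalIntegral.integral_add (ix H.1) (ix H'.1),
    intervalIntegral.integral_add (it H.2) (it H'.2), H.eq_on x hx t ht, H'.eq_on x hx t ht]
  ring

theorem dx_congr {T : ℝ} {u v : ℝ × ℝ → ℝ} (h : ∀ p ∈ rect T, u p = v p) :
    ∀ p ∈ rect T, dx u p = dx v p := fun p hp =>
  derivWithin_congr (fun y hy => h (y, p.2) ⟨hy, hp.2⟩) (h (p.1, p.2) hp)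

theorem dt_congr {T : ℝ} {u v : ℝ × ℝ → ℝ} (h : ∀ p ∈ rect T, u p = v p) :
    ∀ p ∈ rect T, dt T u p = dt T v p := fun p hp =>
  derivWithin_congr (fun s hs => h (p.1, s) ⟨hp.1, hs⟩) (h (p.1, p.2) hp)

theorem DiffX.congr {T : ℝ} {u v : ℝ × ℝ → ℝ} (hu : DiffX T u)
    (h : ∀ p ∈ rect T, v p = u p) : DiffX T v := fun p hp =>
  (hu p hp).congr (fun y hy => h (y, p.2) ⟨hy, hp.2⟩) (h (p.1, p.2) hp)

theorem DiffT.congr {T : ℝ} {u v : ℝ × ℝ → ℝ} (hu : DiffT T u)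
    (h : ∀ p ∈ rect T, v p = u p) : DiffT T v := fun p hp =>
  (hu p hp).congr (fun s hs => h (p.1, s) ⟨hp.1, hs⟩) (h (p.1, p.2) hp)

theorem DiffX.comb {T : ℝ} {u v : ℝ × ℝ → ℝ} (hu : DiffX T u) (hv : DiffX T v) (a b : ℝ) :
    DiffX T (a • u + b • v) := fun p hp =>
  ((hu p hp).const_smul a).add ((hv p hp).const_smul b)

theorem DiffT.comb {T : ℝ} {u v : ℝ × ℝ → ℝ} (hu : DiffT T u) (hv : DiffT T v) (a b : ℝ) :
    DiffT T (a • u + b • v) := fun p hp =>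
  ((hu p hp).const_smul a).add ((hv p hp).const_smul b)

theorem dx_comb {T : ℝ} {u v : ℝ × ℝ → ℝ} (hu : DiffX T u) (hv : DiffX T v) (a b : ℝ) :
    ∀ p ∈ rect T, dx (a • u + b • v) p = (a • dx u + b • dx v) p := fun p hp =>
  (((hu p hp).hasDerivWithinAt.const_smul a).add
    ((hv p hp).hasDerivWithinAt.const_smul b)).derivWithin
      (uniqueDiffOn_Icc zero_lt_one _ hp.1)

theorem dt_comb {T : ℝ} (hT : 0 < T) {u v : ℝ × ℝ → ℝ} (hu : DiffT T u) (hv : DiffT T v)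
    (a b : ℝ) : ∀ p ∈ rect T, dt T (a • u + b • v) p = (a • dt T u + b • dt T v) p :=
  fun p hp => (((hu p hp).hasDerivWithinAt.const_smul a).add
    ((hv p hp).hasDerivWithinAt.const_smul b)).derivWithin (uniqueDiffOn_Icc hT _ hp.2)

theorem MemW.comb {T : ℝ} (hT : 0 < T) {u v : ℝ × ℝ → ℝ} (hu : MemW T u) (hv : MemW T v)
    (a b : ℝ) : MemW T (a • u + b • v) := by
  have e1 := dt_comb hT hu.diff_t hv.diff_t a b
  have e2 : ∀ p ∈ rect T, dt T (dt T (a • u + b • v)) p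
      = (a • dt T (dt T u) + b • dt T (dt T v)) p := fun p hp =>
    (dt_congr e1 p hp).trans (dt_comb hT hu.diff_tt hv.diff_tt a b p hp)
  have e3 : ∀ p ∈ rect T, dx (dt T (dt T (a • u + b • v))) p
      = (a • dx (dt T (dt T u)) + b • dx (dt T (dt T v))) p := fun p hp =>
    (dx_congr e2 p hp).trans (dx_comb hu.diff_xtt hv.diff_xtt a b p hp)
  have e4 : ∀ p ∈ rect T, dx (dx (dt T (dt T (a • u + b • v)))) p
      = (a • dx (dx (dt T (dt T u))) + b • dx (dx (dt T (dt T v)))) p := fun p hp =>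
    (dx_congr e3 p hp).trans (dx_comb hu.diff_xxtt hv.diff_xxtt a b p hp)
  refine ⟨fun p hp => ?_, hu.diff_t.comb hv.diff_t a b, (hu.diff_tt.comb hv.diff_tt a b).congr e1,
    (hu.diff_xtt.comb hv.diff_xtt a b).congr e2, (hu.diff_xxtt.comb hv.diff_xxtt a b).congr e3,
    ((hu.ac_xxtt.smul a).add (hv.ac_xxtt.smul b)).congr e4, fun x hx => ?_, fun x hx => ?_,
    fun t ht => ?_, fun t ht => ?_⟩
  · simp [hu.zero_off p hp, hv.zero_off p hp]
  · simp [hu.initial x hx, hv.initial x hx]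
  · rw [e1 (x, 0) ⟨hx, le_rfl, hT.le⟩]
    simp [hu.initial_t x hx, hv.initial_t x hx]
  · simp [hu.left t ht, hv.left t ht]
  · simp [hu.right t ht, hv.right t ht]

theorem memW_zero (T : ℝ) : MemW T 0 := by
  have t0 : dt T 0 = 0 := by ext p; simp [dt]
  have x0 : dx 0 = 0 := by ext p; simp [dx]
  have hx : DiffX T 0 := fun p _ => differentiableWithinAt_const 0
  have ht : DiffT T 0 := fun p _ => differentiableWithinAt_const 0
  exact ⟨fun _ _ => rfl, ht, by rwa [t0], by rwa [t0, t0], by rwa [t0, t0, x0],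
    by rw [t0, t0, x0, x0]; exact isACL2_zero T, fun _ _ => rfl, fun _ _ => by rw [t0]; rfl,
    fun _ _ => rfl, fun _ _ => rfl⟩

/-- The space `W(Ω)`, a real vector space of functions on `Ω = [0,1] × [0,T]`. -/
def W (T : ℝ) (hT : 0 < T) : Submodule ℝ (ℝ × ℝ → ℝ) where
  carrier := {u | MemW T u}
  zero_mem' := memW_zero T
  add_mem' := fun {u v} hu hv => by simpa using MemW.comb hT hu hv 1 1
  smul_mem' := fun a u hu => by simpa using MemW.comb hT hu hu a 0

/-- The space `Ŵ(Ω)`, a real vector space of functions on `Ω = [0,1] × [0,T]`. -/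
def WHat (T : ℝ) : Submodule ℝ (ℝ × ℝ → ℝ) where
  carrier := {v | MemWHat T v}
  zero_mem' := ⟨fun _ _ => rfl, isACL2_zero T⟩
  add_mem' := fun hu hv =>
    ⟨fun p hp => by simp [hu.zero_off p hp, hv.zero_off p hp], hu.ac.add hv.ac⟩
  smul_mem' := fun a _ hu => ⟨fun p hp => by simp [hu.zero_off p hp], hu.ac.smul a⟩

/-- The inner product of `W₂³[0,1]`. -/
def innerW23 (p q : ℝ → ℝ) : ℝ :=
  p 0 * q 0
    + derivWithin p (Icc 0 1) 0 * derivWithin q (Icc 0 1) 0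
    + derivWithin p (Icc 0 1) 1 * derivWithin q (Icc 0 1) 1
    + ∫ x in (0 : ℝ)..1,
        iteratedDerivWithin 3 p (Icc 0 1) x * iteratedDerivWithin 3 q (Icc 0 1) x

/-- The inner product of `W₂¹[0,1]`. -/
def innerW21 (p q : ℝ → ℝ) : ℝ :=
  p 0 * q 0 + ∫ x in (0 : ℝ)..1, derivWithin p (Icc 0 1) x * derivWithin q (Icc 0 1) x

/-- The inner product of `W(Ω)`. All derivatives that occur exist everywhere on `Ω` or almost
everywhere, on elements of `W(Ω)`. -/
def innerW (T : ℝ) (u g : ℝ × ℝ → ℝ) : ℝ :=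
  (∑ i ∈ Finset.range 3, ∫ t in (0 : ℝ)..T,
      (dt T)^[3] (dx^[i] u) (0, t) * (dt T)^[3] (dx^[i] g) (0, t))
    + (∑ j ∈ Finset.range 3,
        innerW23 (fun x => (dt T)^[j] u (x, 0)) (fun x => (dt T)^[j] g (x, 0)))
    + ∫ x in (0 : ℝ)..1, ∫ t in (0 : ℝ)..T,
        dx^[3] ((dt T)^[3] u) (x, t) * dx^[3] ((dt T)^[3] g) (x, t)

/-- The norm of `W(Ω)`. -/
def normW (T : ℝ) (u : ℝ × ℝ → ℝ) : ℝ := √(innerW T u u)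

/-- The inner product of `Ŵ(Ω)`. -/
def innerWHat (T : ℝ) (u g : ℝ × ℝ → ℝ) : ℝ :=
  (∫ t in (0 : ℝ)..T, dt T u (0, t) * dt T g (0, t))
    + innerW21 (fun x => u (x, 0)) (fun x => g (x, 0))
    + ∫ x in (0 : ℝ)..1, ∫ t in (0 : ℝ)..T, dx (dt T u) (x, t) * dx (dt T g) (x, t)

/-- The norm of `Ŵ(Ω)`. -/
def normWHat (T : ℝ) (v : ℝ × ℝ → ℝ) : ℝ := √(innerWHat T v v)

/-- The wave operator `L v = ∂²v/∂t² - ∂²v/∂x²` on `Ω`. -/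
def waveOp (T : ℝ) (v : ℝ × ℝ → ℝ) : ℝ × ℝ → ℝ :=
  (rect T).indicator fun p => dt T (dt T v) p - dx (dx v) p

end SineGordon

end

noncomputable section

namespace SineGordon

open Filter Topology

/-! Write φ = ∂⁴u/∂x²∂t², with corner value c and square integrable densities g, h, k. Everything
about u is an explicit integral of φ. The function u_tt vanishes on x = 0 and x = 1 and has second
x-derivative φ, so it is the solution `accel` of a two-point boundary value problem
(`eq_of_second_deriv`), and the initial conditions make u its double primitive in time
(`MemW.exists_densities`). Differentiation under the time integrals then shows that u_x and u_xx
exist, u_xx being the double time primitive of φ. Hence Lu is a double x-primitive of φ minus the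
double time primitive of φ, and Fubini yields its densities (`hasDensities_wave`).

Both norms turn into L² norms. The squared Ŵ-norm is the sum of the squares of the corner value and
of the L² norms of the densities (`HasDensities.innerWHat_self`). The squared W-norm dominates ∫h² +
u_xtt(0,0)² + ∫g² + ∬k² (`le_innerW`). The number c does not itself occur in the W-norm, but the
boundary conditions express it through u_xtt(0,0) and g (`c_sq_le`). Cauchy–Schwarz does the rest.

The delicate point is that the norms contain pointwise derivatives taken one after another: ∂_x∂_t f
at (x,t) needs ∂_t f along the whole slice of height t. So the null set of bad t must not depend on
x (`ae_forall_hasDerivAt_primitive`); afterwards k is recovered by Lebesgue differentiation in x and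
Fubini (`ae_ae_hasDerivAt_primitive`). -/

/-! ### Measurability of primitives and Cauchy–Schwarz on intervals. -/

theorem measurable_primitive_fst {F : ℝ × ℝ → ℝ} (hF : Measurable F) :
    Measurable fun p : ℝ × ℝ => ∫ z in (0 : ℝ)..p.1, F (z, p.2) := by
  have key : ∀ s : Set ((ℝ × ℝ) × ℝ), MeasurableSet s →
      Measurable fun p : ℝ × ℝ =>
        ∫ z, s.indicator (fun q : (ℝ × ℝ) × ℝ => F (q.2, q.1.2)) (p, z) := by
    intro s hs
    refine StronglyMeasurable.measurable
      (StronglyMeasurable.integral_prod_right' (f := s.indicator _) ?_)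
    exact ((hF.comp (by fun_prop)).indicator hs).stronglyMeasurable
  -- The variable endpoint is moved into the integrand: the oriented integral is the one over 0 < z
  -- ≤ x minus the one over x < z ≤ 0, and both regions are measurable in all variables jointly.
  have m1 : MeasurableSet {q : (ℝ × ℝ) × ℝ | 0 < q.2 ∧ q.2 ≤ q.1.1} :=
    (measurableSet_lt measurable_const measurable_snd).inter
      (measurableSet_le measurable_snd (measurable_fst.comp measurable_fst))
  have m2 : MeasurableSet {q : (ℝ × ℝ) × ℝ | q.1.1 < q.2 ∧ q.2 ≤ 0} :=
    (measurableSet_lt (measurable_fst.comp measurable_fst) measurable_snd).inter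
      (measurableSet_le measurable_snd measurable_const)
  convert (key _ m1).sub (key _ m2) using 1
  ext p
  simp only [intervalIntegral, Pi.sub_apply]
  rw [← integral_indicator measurableSet_Ioc, ← integral_indicator measurableSet_Ioc]
  rfl

theorem measurable_primitive_snd {F : ℝ × ℝ → ℝ} (hF : Measurable F) :
    Measurable fun p : ℝ × ℝ => ∫ s in (0 : ℝ)..p.2, F (p.1, s) :=
  (measurable_primitive_fst (hF.comp measurable_swap)).comp measurable_swap

theorem integrable_of_integrable_sq {α : Type*} [MeasurableSpace α] {μ : Measure α} {S : Set α}
    (hμ : μ S ≠ ⊤) {F : α → ℝ} (hF : Measurable F) (h0 : ∀ a ∉ S, F a = 0)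
    (h2 : Integrable (fun a => F a ^ 2) μ) : Integrable F μ := by
  have : Fact (μ S < ⊤) := ⟨hμ.lt_top⟩
  have hL : MemLp F 2 (μ.restrict S) :=
    (memLp_two_iff_integrable_sq hF.aestronglyMeasurable).2 h2.integrableOn
  exact IntegrableOn.integrable_of_forall_notMem_eq_zero (s := S)
    (hL.integrable (by norm_num)) h0

/-- Cauchy–Schwarz against the constant 1, from nonnegativity of the variance about the mean `m`. -/
theorem sq_intervalIntegral_le {L : ℝ} (hL : 0 ≤ L) {F : ℝ → ℝ}
    (h1 : IntervalIntegrable F volume 0 L)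
    (h2 : IntervalIntegrable (fun s => F s ^ 2) volume 0 L) :
    (∫ s in (0 : ℝ)..L, F s) ^ 2 ≤ L * ∫ s in (0 : ℝ)..L, F s ^ 2 := by
  rcases hL.eq_or_lt with rfl | hL
  · simp
  set m := (∫ s in (0 : ℝ)..L, F s) / L with hm
  have e : ∫ s in (0 : ℝ)..L, (F s - m) ^ 2
      = (∫ s in (0 : ℝ)..L, F s ^ 2) - 2 * m * (∫ s in (0 : ℝ)..L, F s) + L * m ^ 2 := by
    have : ∀ s, (F s - m) ^ 2 = F s ^ 2 - 2 * m * F s + m ^ 2 := fun s => by ring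
    simp only [this]
    rw [intervalIntegral.integral_add (h2.sub (h1.const_mul _)) (by simp),
      intervalIntegral.integral_sub h2 (h1.const_mul _), intervalIntegral.integral_const_mul]
    simp
  have p : 0 ≤ ∫ s in (0 : ℝ)..L, (F s - m) ^ 2 :=
    intervalIntegral.integral_nonneg hL.le fun s _ => sq_nonneg _
  have hI : (∫ s in (0 : ℝ)..L, F s) = m * L := by rw [hm]; field_simp
  rw [hI] at e ⊢
  rw [e] at p
  nlinarith [mul_nonneg hL.le p]

theorem integral_eq_intervalIntegral {L : ℝ} (hL : 0 ≤ L) {F : ℝ → ℝ}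
    (h0 : ∀ s ∉ Icc 0 L, F s = 0) : ∫ s, F s = ∫ s in (0 : ℝ)..L, F s := by
  rw [intervalIntegral.integral_of_le hL, ← integral_Icc_eq_integral_Ioc,
    setIntegral_eq_integral_of_forall_compl_eq_zero h0]

theorem sq_integral_abs_le {L : ℝ} (hL : 0 ≤ L) {F : ℝ → ℝ} (h0 : ∀ s ∉ Icc 0 L, F s = 0)
    (h1 : Integrable F) (h2 : Integrable fun s => F s ^ 2) :
    (∫ s, |F s|) ^ 2 ≤ L * ∫ s, F s ^ 2 := by
  rw [integral_eq_intervalIntegral hL fun s hs => by simp [h0 s hs],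
    integral_eq_intervalIntegral hL fun s hs => by simp [h0 s hs]]
  simpa using sq_intervalIntegral_le (F := fun s => |F s|) hL h1.abs.intervalIntegrable
    (by simpa using h2.intervalIntegrable)

theorem abs_intervalIntegral_le {F : ℝ → ℝ} (h : Integrable F) (a b : ℝ) :
    |∫ s in a..b, F s| ≤ ∫ s, |F s| :=
  (intervalIntegral.norm_integral_le_integral_norm_uIoc (f := F) (μ := volume)).trans
    (setIntegral_le_integral h.norm (ae_of_all _ fun _ => norm_nonneg _))

theorem integrable_primitive_fst {k : ℝ × ℝ → ℝ} (hm : Measurable k) (hk : Integrable k)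
    (hr : ∀ t, Integrable fun x => k (x, t)) (x : ℝ) :
    Integrable fun t => ∫ y in (0 : ℝ)..x, k (y, t) := by
  refine (hk.integral_norm_prod_right).mono' ?_ (ae_of_all _ fun t => ?_)
  · exact ((measurable_primitive_fst hm).comp (measurable_prodMk_left (x := x))).aestronglyMeasurable
  · exact abs_intervalIntegral_le (hr t) _ _

/-! ### Almost everywhere differentiation of double primitives. -/

/-- For k ≥ 0 the inner primitive increases with x, hence so do the difference quotients in t.
Lebesgue's theorem at the countably many rational x gives a single null set; at a real x the
quotients are squeezed between those at nearby rationals, whose limits are close because the inner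
primitive is continuous in x. -/
theorem ae_forall_hasDerivAt_primitive_of_nonneg {k : ℝ × ℝ → ℝ} (hm : Measurable k)
    (hk : Integrable k) (hr : ∀ t, Integrable fun x => k (x, t)) (h0 : ∀ p, 0 ≤ k p) :
    ∀ᵐ t : ℝ, ∀ x : ℝ, HasDerivAt (fun t => ∫ s in (0 : ℝ)..t, ∫ y in (0 : ℝ)..x, k (y, s))
      (∫ y in (0 : ℝ)..x, k (y, t)) t := by
  set P : ℝ → ℝ → ℝ := fun x s => ∫ y in (0 : ℝ)..x, k (y, s) with hP
  have iP : ∀ x, Integrable (P x) := integrable_primitive_fst hm hk hr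
  have cP : ∀ s, Continuous fun x => P x s := fun s => (hr s).continuous_primitive 0
  have mP : ∀ s, Monotone fun x => P x s := fun s a b hab => by
    have e := intervalIntegral.integral_interval_sub_left (f := fun y => k (y, s)) (μ := volume)
      (a := 0) (b := b) (c := a) (hr s).intervalIntegrable (hr s).intervalIntegrable
    have := intervalIntegral.integral_nonneg (f := fun y => k (y, s)) (μ := volume) hab
      fun y _ => h0 (y, s)
    simp only [hP]
    linarith
  have mS : ∀ t t' a b : ℝ, a ≤ b →
      slope (fun t => ∫ s in (0 : ℝ)..t, P a s) t t'
        ≤ slope (fun t => ∫ s in (0 : ℝ)..t, P b s) t t' := by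
    intro t t' a b hab
    have e : ∀ x, (∫ s in (0 : ℝ)..t', P x s) - ∫ s in (0 : ℝ)..t, P x s
        = ∫ s in t..t', P x s := fun x =>
      intervalIntegral.integral_interval_sub_left (iP x).intervalIntegrable
        (iP x).intervalIntegrable
    simp only [slope_def_field, e]
    rcases le_total t t' with h | h
    · exact div_le_div_of_nonneg_right (intervalIntegral.integral_mono h
        (iP a).intervalIntegrable (iP b).intervalIntegrable fun s => mP s hab) (sub_nonneg.2 h)
    -- For t' ≤ t both the orientation of the integral and the sign of the denominator flip, so
    -- monotonicity survives.
    · refine div_le_div_of_nonpos_of_le (sub_nonpos.2 h) ?_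
      rw [intervalIntegral.integral_symm t' t, intervalIntegral.integral_symm t' t]
      exact neg_le_neg (intervalIntegral.integral_mono h
        (iP a).intervalIntegrable (iP b).intervalIntegrable fun s => mP s hab)
  have A : ∀ᵐ t : ℝ, ∀ q : ℚ, HasDerivAt (fun t => ∫ s in (0 : ℝ)..t, P q s) (P q t) t := by
    rw [ae_all_iff]
    intro q
    filter_upwards [LocallyIntegrable.ae_hasDerivAt_integral (iP q).locallyIntegrable] with t ht using ht 0
  filter_upwards [A] with t ht x
  have ht' := fun q => hasDerivAt_iff_tendsto_slope.1 (ht q)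
  rw [hasDerivAt_iff_tendsto_slope, tendsto_order]
  constructor
  · intro c hc
    obtain ⟨δ, hδ, hb⟩ := Metric.eventually_nhds_iff.1
      ((cP t).continuousAt.eventually (lt_mem_nhds hc))
    obtain ⟨q, hq1, hq2⟩ := exists_rat_btwn (sub_lt_self x hδ)
    have hcq : c < P q t := hb (by rw [Real.dist_eq, abs_lt]; constructor <;> linarith)
    filter_upwards [(tendsto_order.1 (ht' q)).1 c hcq] with t' h'
    exact h'.trans_le (mS t t' q x hq2.le)
  · intro c hc
    obtain ⟨δ, hδ, hb⟩ := Metric.eventually_nhds_iff.1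
      ((cP t).continuousAt.eventually (gt_mem_nhds hc))
    obtain ⟨q, hq1, hq2⟩ := exists_rat_btwn (lt_add_of_pos_right x hδ)
    have hcq : P q t < c := hb (by rw [Real.dist_eq, abs_lt]; constructor <;> linarith)
    filter_upwards [(tendsto_order.1 (ht' q)).2 c hcq] with t' h'
    exact (mS t t' x q hq1.le).trans_lt h'

theorem ae_forall_hasDerivAt_primitive {k : ℝ × ℝ → ℝ} (hm : Measurable k)
    (hk : Integrable k) (hr : ∀ t, Integrable fun x => k (x, t)) :
    ∀ᵐ t : ℝ, ∀ x : ℝ, HasDerivAt (fun t => ∫ s in (0 : ℝ)..t, ∫ y in (0 : ℝ)..x, k (y, s))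
      (∫ y in (0 : ℝ)..x, k (y, t)) t := by
  have m1 : Measurable fun p => max (k p) 0 := hm.max measurable_const
  have m2 : Measurable fun p => max (-k p) 0 := hm.neg.max measurable_const
  have r1 : ∀ t, Integrable fun x => max (k (x, t)) 0 := fun t => (hr t).pos_part
  have r2 : ∀ t, Integrable fun x => max (-k (x, t)) 0 := fun t => (hr t).neg_part
  have e : ∀ s x, ∫ y in (0 : ℝ)..x, k (y, s)
      = (∫ y in (0 : ℝ)..x, max (k (y, s)) 0) - ∫ y in (0 : ℝ)..x, max (-k (y, s)) 0 := by
    intro s x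
    rw [← intervalIntegral.integral_sub (r1 s).intervalIntegrable (r2 s).intervalIntegrable]
    exact intervalIntegral.integral_congr fun y _ => (max_zero_sub_max_neg_zero_eq_self _).symm
  filter_upwards [ae_forall_hasDerivAt_primitive_of_nonneg m1 hk.pos_part r1
      fun p => le_max_right _ _,
    ae_forall_hasDerivAt_primitive_of_nonneg m2 hk.neg_part r2 fun p => le_max_right _ _]
    with t h1 h2 x
  rw [e]
  refine ((h1 x).sub (h2 x)).congr_of_eventuallyEq (Eventually.of_forall fun t' => ?_)
  simp only [e, Pi.sub_apply]
  rw [← intervalIntegral.integral_sub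
    (integrable_primitive_fst m1 hk.pos_part r1 x).intervalIntegrable
    (integrable_primitive_fst m2 hk.neg_part r2 x).intervalIntegrable]

/-- By continuity, a real increment whose quotient is at least ε away from `d` has rational
increments nearby whose quotients are more than ε/2 away. Differentiability thus becomes a
countable, hence measurable, condition. -/
theorem hasDerivAt_of_tendsto_rat {G : ℝ → ℝ} (hG : Continuous G) {x d : ℝ}
    (h : Tendsto (fun q : ℚ => (q : ℝ)⁻¹ * (G (x + q) - G x))
      (comap (fun q : ℚ => (q : ℝ)) (𝓝[≠] 0)) (𝓝 d)) : HasDerivAt G d x := by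
  rw [hasDerivAt_iff_tendsto_slope_zero, Metric.tendsto_nhds]
  intro ε hε
  have h1 := (Metric.tendsto_nhds.1 h (ε / 2) (half_pos hε))
  rw [eventually_comap, eventually_nhdsWithin_iff, Metric.eventually_nhds_iff] at h1
  obtain ⟨δ, hδ, h1⟩ := h1
  rw [eventually_nhdsWithin_iff, Metric.eventually_nhds_iff]
  refine ⟨δ, hδ, fun r hr hr0 => ?_⟩
  by_contra hc
  have hc' : ε / 2 < dist (r⁻¹ * (G (x + r) - G x)) d := by
    simp only [smul_eq_mul, not_lt] at hc
    linarith
  have hr0' : r ≠ 0 := hr0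
  have cont : ContinuousAt (fun r : ℝ => dist (r⁻¹ * (G (x + r) - G x)) d) r := by
    have : ContinuousAt (fun r : ℝ => r⁻¹) r := continuousAt_inv₀ hr0'
    fun_prop
  have ev : ∀ᶠ r' in 𝓝 r, ε / 2 < dist (r'⁻¹ * (G (x + r') - G x)) d ∧ dist r' 0 < δ ∧ r' ≠ 0 :=
    (cont.eventually (lt_mem_nhds hc')).and
      (((continuous_id.dist continuous_const).continuousAt.eventually (gt_mem_nhds hr)).and
        (isOpen_ne.mem_nhds hr0'))
  obtain ⟨r', ⟨q, rfl⟩, hr'⟩ := Rat.denseRange_cast.inter_nhds_nonempty ev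
  exact absurd (h1 hr'.2.1 hr'.2.2 q rfl) (not_lt.2 hr'.1.le)

/-- Lebesgue differentiation gives, for each t, almost every x; Fubini exchanges the quantifiers.
This needs a measurable set of good points, which is why only rational increments enter `D`. -/
theorem ae_ae_hasDerivAt_primitive {k : ℝ × ℝ → ℝ} (hm : Measurable k)
    (hr : ∀ t, Integrable fun x => k (x, t)) :
    ∀ᵐ x : ℝ, ∀ᵐ t : ℝ, HasDerivAt (fun x => ∫ y in (0 : ℝ)..x, k (y, t)) (k (x, t)) x := by
  set G : ℝ × ℝ → ℝ := fun p => ∫ y in (0 : ℝ)..p.1, k (y, p.2) with hG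
  have mG : Measurable G := measurable_primitive_fst hm
  set D : Set (ℝ × ℝ) := {p | Tendsto (fun q : ℚ => (q : ℝ)⁻¹ * (G (p.1 + q, p.2) - G p))
    (comap (fun q : ℚ => (q : ℝ)) (𝓝[≠] 0)) (𝓝 (k p))} with hD
  have mD : MeasurableSet D := by
    refine measurableSet_tendsto_fun (fun q => ?_) hm
    exact ((mG.comp (by fun_prop)).sub mG).const_mul _
  have mD' : MeasurableSet (Prod.swap ⁻¹' D) := measurable_swap mD
  have h1 : ∀ᵐ t : ℝ, ∀ᵐ x : ℝ, (t, x) ∈ Prod.swap ⁻¹' D := by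
    refine ae_of_all _ fun t => ?_
    filter_upwards [LocallyIntegrable.ae_hasDerivAt_integral (hr t).locallyIntegrable] with x hx
    have h2 := hasDerivAt_iff_tendsto_slope_zero.1 (hx 0)
    exact h2.comp tendsto_comap
  have h2 : ∀ᵐ p : ℝ × ℝ ∂(volume.prod volume), p ∈ Prod.swap ⁻¹' D :=
    (Measure.ae_prod_mem_iff_ae_ae_mem mD').2 h1
  have h3 : ∀ᵐ p : ℝ × ℝ ∂(volume.prod volume), p ∈ D := by
    have := (Measure.measurePreserving_swap (μ := (volume : Measure ℝ))
      (ν := (volume : Measure ℝ))).quasiMeasurePreserving.ae h2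
    simpa using this
  filter_upwards [Measure.ae_ae_of_ae_prod h3] with x hx
  filter_upwards [hx] with t ht
  exact hasDerivAt_of_tendsto_rat ((hr t).continuous_primitive 0) ht

/-! ### Almost everywhere congruence and normalization of densities. -/

theorem integral_congr_Ioo {a b : ℝ} (hab : a ≤ b) {f g : ℝ → ℝ}
    (h : ∀ᵐ x, x ∈ Ioo a b → f x = g x) : ∫ x in a..b, f x = ∫ x in a..b, g x := by
  refine intervalIntegral.integral_congr_ae ?_
  filter_upwards [h, Measure.ae_ne volume b] with x hx hb hm
  rw [uIoc_of_le hab] at hm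
  exact hx ⟨hm.1, lt_of_le_of_ne hm.2 hb⟩

theorem integral_integral_congr_Ioo {T : ℝ} (hT : 0 ≤ T) {F G : ℝ × ℝ → ℝ}
    (h : ∀ᵐ x : ℝ, ∀ᵐ t : ℝ, x ∈ Ioo (0 : ℝ) 1 → t ∈ Ioo 0 T → F (x, t) = G (x, t)) :
    ∫ x in (0 : ℝ)..1, ∫ t in (0 : ℝ)..T, F (x, t)
      = ∫ x in (0 : ℝ)..1, ∫ t in (0 : ℝ)..T, G (x, t) := by
  refine integral_congr_Ioo zero_le_one ?_
  filter_upwards [h] with x hx hxm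
  refine integral_congr_Ioo hT ?_
  filter_upwards [hx] with t ht htm using ht hxm htm

theorem integral_integral_eq_setIntegral {T : ℝ} {F : ℝ × ℝ → ℝ} (hF : IntegrableOn F (rect T))
    {x t : ℝ} (hx : x ∈ Icc (0 : ℝ) 1) (ht : t ∈ Icc 0 T) :
    ∫ y in (0 : ℝ)..x, ∫ s in (0 : ℝ)..t, F (y, s) = ∫ p in Ioc 0 x ×ˢ Ioc 0 t, F p := by
  have sub : Ioc 0 x ×ˢ Ioc 0 t ⊆ rect T :=
    prod_mono (fun y hy => ⟨hy.1.le, hy.2.trans hx.2⟩) fun y hy => ⟨hy.1.le, hy.2.trans ht.2⟩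
  simp only [intervalIntegral.integral_of_le hx.1, intervalIntegral.integral_of_le ht.1]
  exact (setIntegral_prod F (hF.mono_set sub)).symm

theorem measurableSet_rect (T : ℝ) : MeasurableSet (rect T) :=
  measurableSet_Icc.prod measurableSet_Icc

theorem volume_rect_ne_top (T : ℝ) : volume (rect T) ≠ ⊤ :=
  (isCompact_Icc.prod isCompact_Icc).measure_lt_top.ne

theorem exists_measurable_indicator {α : Type*} [MeasurableSpace α] {μ : Measure α} {S : Set α}
    (hS : MeasurableSet S) {g : α → ℝ} (hg : MemLp g 2 (μ.restrict S)) :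
    ∃ g' : α → ℝ, Measurable g' ∧ (∀ x ∉ S, g' x = 0) ∧ Integrable (fun x => g' x ^ 2) μ ∧
      ∀ᵐ x ∂μ, x ∈ S → g' x = g x := by
  have hm : Measurable (S.indicator (hg.1.mk g)) :=
    hg.1.stronglyMeasurable_mk.measurable.indicator hS
  refine ⟨S.indicator (hg.1.mk g), hm, fun x hx => indicator_of_notMem hx _, ?_, ?_⟩
  · rw [← memLp_two_iff_integrable_sq hm.aestronglyMeasurable, memLp_indicator_iff_restrict hS]
    exact hg.ae_eq hg.1.ae_eq_mk
  · filter_upwards [(ae_restrict_iff' hS).1 hg.1.ae_eq_mk] with x hx hxS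
    rw [indicator_of_mem hxS, hx hxS]

/-- Square integrable densities of an absolutely continuous function on `Ω`, extended by zero
and represented by Borel functions all of whose slices are square integrable. -/
structure L2Densities (T : ℝ) where
  /-- the value at the corner -/
  c : ℝ
  /-- the density of the restriction to the edge `t = 0` -/
  g : ℝ → ℝ
  /-- the density of the restriction to the edge `x = 0` -/
  h : ℝ → ℝ
  /-- the mixed density -/
  k : ℝ × ℝ → ℝ
  measurable_g : Measurable g
  measurable_h : Measurable h
  measurable_k : Measurable k
  g_off : ∀ x ∉ Icc (0 : ℝ) 1, g x = 0
  h_off : ∀ t ∉ Icc 0 T, h t = 0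
  k_off : ∀ p ∉ rect T, k p = 0
  integrable_g_sq : Integrable fun x => g x ^ 2
  integrable_h_sq : Integrable fun t => h t ^ 2
  integrable_k_sq : Integrable fun p => k p ^ 2
  integrable_k_sq_left : ∀ x, Integrable fun t => k (x, t) ^ 2
  integrable_k_sq_right : ∀ t, Integrable fun x => k (x, t) ^ 2

/-- By Fubini almost every slice is square integrable. Setting k to zero outside A × B, where A and
B collect the good slices, changes it only on a null set and repairs every slice. -/
theorem exists_measurable_slices {T : ℝ} {k : ℝ × ℝ → ℝ}
    (hk : MemLp k 2 (volume.restrict (rect T))) :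
    ∃ k' : ℝ × ℝ → ℝ, Measurable k' ∧ (∀ p ∉ rect T, k' p = 0) ∧
      Integrable (fun p => k' p ^ 2) ∧ (∀ x, Integrable fun t => k' (x, t) ^ 2) ∧
      (∀ t, Integrable fun x => k' (x, t) ^ 2) ∧ ∀ᵐ p, p ∈ rect T → k' p = k p := by
  obtain ⟨k1, hm, h0, h2, he⟩ := exists_measurable_indicator (measurableSet_rect T) hk
  have hm2 : Measurable fun p => k1 p ^ 2 := hm.pow_const 2
  set A : Set ℝ := {x | Integrable fun t => k1 (x, t) ^ 2} with hA
  set B : Set ℝ := {t | Integrable fun x => k1 (x, t) ^ 2} with hB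
  have mA : MeasurableSet A :=
    measurableSet_integrable (f := fun x t => k1 (x, t) ^ 2) hm2.stronglyMeasurable
  have mB : MeasurableSet B :=
    measurableSet_integrable (f := fun t x => k1 (x, t) ^ 2)
      (hm2.comp measurable_swap).stronglyMeasurable
  have aA : ∀ᵐ p : ℝ × ℝ, p.1 ∈ A :=
    (Measure.quasiMeasurePreserving_fst (μ := volume) (ν := volume)).ae h2.prod_right_ae
  have aB : ∀ᵐ p : ℝ × ℝ, p.2 ∈ B :=
    (Measure.quasiMeasurePreserving_snd (μ := volume) (ν := volume)).ae h2.prod_left_ae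
  have e : ∀ p, (A ×ˢ B).indicator k1 p ^ 2 = (A ×ˢ B).indicator (fun p => k1 p ^ 2) p := by
    intro p
    by_cases hp : p ∈ A ×ˢ B <;> simp [hp]
  refine ⟨(A ×ˢ B).indicator k1, hm.indicator (mA.prod mB), fun p hp => ?_, ?_, fun x => ?_,
    fun t => ?_, ?_⟩
  · by_cases hp' : p ∈ A ×ˢ B <;> simp [hp', h0 p hp]
  · simp only [e]
    exact h2.indicator (mA.prod mB)
  · simp only [e]
    by_cases hx : x ∈ A
    · have : Integrable (B.indicator fun t => k1 (x, t) ^ 2) := Integrable.indicator hx mB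
      refine this.congr (ae_of_all _ fun t => ?_)
      by_cases ht : t ∈ B <;> simp [hx, ht]
    · simp [hx]
  · simp only [e]
    by_cases ht : t ∈ B
    · have : Integrable (A.indicator fun x => k1 (x, t) ^ 2) := Integrable.indicator ht mA
      refine this.congr (ae_of_all _ fun x => ?_)
      by_cases hx : x ∈ A <;> simp [hx, ht]
    · simp [ht]
  · filter_upwards [aA, aB, he] with p h1 h2 h3 hp
    rw [indicator_of_mem (mem_prod.2 ⟨h1, h2⟩), h3 hp]

/-! ### The function with given densities and its first derivatives. -/

namespace L2Densities

variable {T : ℝ} (D : L2Densities T)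

/-- The absolutely continuous function with the given densities, extended to the plane. -/
def toFun (p : ℝ × ℝ) : ℝ :=
  D.c + (∫ y in (0 : ℝ)..p.1, D.g y) + (∫ s in (0 : ℝ)..p.2, D.h s)
    + ∫ y in (0 : ℝ)..p.1, ∫ s in (0 : ℝ)..p.2, D.k (y, s)

/-- The derivative in `t`. -/
def derivT (p : ℝ × ℝ) : ℝ := D.h p.2 + ∫ y in (0 : ℝ)..p.1, D.k (y, p.2)

/-- The derivative in `x`. -/
def derivX (p : ℝ × ℝ) : ℝ := D.g p.1 + ∫ s in (0 : ℝ)..p.2, D.k (p.1, s)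

theorem integrable_g : Integrable D.g :=
  integrable_of_integrable_sq isCompact_Icc.measure_lt_top.ne D.measurable_g D.g_off
    D.integrable_g_sq

theorem integrable_h : Integrable D.h :=
  integrable_of_integrable_sq isCompact_Icc.measure_lt_top.ne D.measurable_h D.h_off
    D.integrable_h_sq

theorem integrable_k : Integrable D.k :=
  integrable_of_integrable_sq (volume_rect_ne_top T) D.measurable_k D.k_off D.integrable_k_sq

theorem k_off_left (x : ℝ) : ∀ t ∉ Icc 0 T, D.k (x, t) = 0 := fun _ ht =>
  D.k_off _ fun hp => ht hp.2

theorem k_off_right (t : ℝ) : ∀ x ∉ Icc (0 : ℝ) 1, D.k (x, t) = 0 := fun _ hx =>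
  D.k_off _ fun hp => hx hp.1

theorem integrable_k_left (x : ℝ) : Integrable fun t => D.k (x, t) :=
  integrable_of_integrable_sq isCompact_Icc.measure_lt_top.ne
    (D.measurable_k.comp measurable_prodMk_left) (D.k_off_left x) (D.integrable_k_sq_left x)

theorem integrable_k_right (t : ℝ) : Integrable fun x => D.k (x, t) :=
  integrable_of_integrable_sq isCompact_Icc.measure_lt_top.ne
    (D.measurable_k.comp measurable_prodMk_right) (D.k_off_right t) (D.integrable_k_sq_right t)

theorem swap_k (x t : ℝ) : ∫ y in (0 : ℝ)..x, ∫ s in (0 : ℝ)..t, D.k (y, s)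
    = ∫ s in (0 : ℝ)..t, ∫ y in (0 : ℝ)..x, D.k (y, s) :=
  intervalIntegral_intervalIntegral_swap (F := fun y s => D.k (y, s)) D.integrable_k.integrableOn

theorem continuous_toFun : Continuous D.toFun := by
  have h1 : Continuous fun p : ℝ × ℝ =>
      ∫ y in (0 : ℝ)..p.2, ∫ s in (0 : ℝ)..p.1, D.k (y, s) := by
    rw [continuous_iff_continuousAt]
    rintro ⟨t, x⟩
    -- Here t is the parameter and x the moving endpoint; the inner integral is dominated by
    -- ∫|k(y,s)| ds uniformly in t.
    refine intervalIntegral.continuousAt_parametric_primitive_of_dominated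
      (F := fun t y => ∫ s in (0 : ℝ)..t, D.k (y, s))
      (fun y => ∫ s, |D.k (y, s)|) (min 0 x - 1) (max 0 x + 1) (fun t' => ?_)
      (Eventually.of_forall fun t' => ae_of_all _ fun y =>
        abs_intervalIntegral_le (D.integrable_k_left y) _ _) ?_
      (ae_of_all _ fun y => ((D.integrable_k_left y).continuous_primitive 0).continuousAt)
      ⟨by linarith [min_le_left 0 x], by linarith [le_max_left 0 x]⟩
      ⟨by linarith [min_le_right 0 x], by linarith [le_max_right 0 x]⟩ (by simp)
    · exact ((measurable_primitive_snd D.measurable_k).comp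
        (measurable_prodMk_right (y := t'))).aestronglyMeasurable
    · exact (Integrable.integral_norm_prod_left (μ := volume) (ν := volume)
        D.integrable_k).intervalIntegrable
  exact ((continuous_const.add ((D.integrable_g.continuous_primitive 0).comp continuous_fst)).add
    ((D.integrable_h.continuous_primitive 0).comp continuous_snd)).add (h1.comp continuous_swap)

theorem integrable_primitive_k_left (t : ℝ) : Integrable fun y => ∫ s in (0 : ℝ)..t, D.k (y, s) :=
  integrable_primitive_fst (k := D.k ∘ Prod.swap) (D.measurable_k.comp measurable_swap)
    D.integrable_k.swap D.integrable_k_left t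

theorem integrable_primitive_k_right (x : ℝ) :
    Integrable fun s => ∫ y in (0 : ℝ)..x, D.k (y, s) :=
  integrable_primitive_fst D.measurable_k D.integrable_k D.integrable_k_right x

theorem toFun_eq_add_integral_derivT (x t : ℝ) :
    D.toFun (x, t) = D.toFun (x, 0) + ∫ s in (0 : ℝ)..t, D.derivT (x, s) := by
  simp only [toFun, derivT]
  rw [intervalIntegral.integral_add D.integrable_h.intervalIntegrable
    (D.integrable_primitive_k_right x).intervalIntegrable, D.swap_k]
  simp
  ring

theorem toFun_eq_add_integral_derivX (x t : ℝ) :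
    D.toFun (x, t) = D.toFun (0, t) + ∫ y in (0 : ℝ)..x, D.derivX (y, t) := by
  simp only [toFun, derivX]
  rw [intervalIntegral.integral_add D.integrable_g.intervalIntegrable
    (D.integrable_primitive_k_left t).intervalIntegrable]
  simp
  ring

/-- After exchanging the integrals, t is the outer variable, and one null set of t serves every x.
-/
theorem ae_hasDerivAt_toFun_snd :
    ∀ᵐ t : ℝ, ∀ x, HasDerivAt (fun t => D.toFun (x, t)) (D.derivT (x, t)) t := by
  filter_upwards [LocallyIntegrable.ae_hasDerivAt_integral D.integrable_h.locallyIntegrable,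
    ae_forall_hasDerivAt_primitive D.measurable_k D.integrable_k D.integrable_k_right]
    with t h1 h2 x
  simp only [toFun, derivT, D.swap_k]
  exact ((h1 0).const_add _).add (h2 x)

theorem ae_hasDerivAt_toFun_fst :
    ∀ᵐ x : ℝ, HasDerivAt (fun x => D.toFun (x, 0)) (D.g x) x := by
  filter_upwards [LocallyIntegrable.ae_hasDerivAt_integral D.integrable_g.locallyIntegrable]
    with x h1
  have := (h1 0).const_add D.c
  simpa [toFun] using this

theorem ae_hasDerivAt_derivT :
    ∀ᵐ x : ℝ, ∀ᵐ t : ℝ, HasDerivAt (fun x => D.derivT (x, t)) (D.k (x, t)) x := by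
  filter_upwards [ae_ae_hasDerivAt_primitive D.measurable_k D.integrable_k_right] with x hx
  filter_upwards [hx] with t ht using ht.const_add (D.h t)

theorem continuous_derivT_fst (t : ℝ) : Continuous fun x => D.derivT (x, t) :=
  (continuous_const (y := D.h t)).add ((D.integrable_k_right t).continuous_primitive 0)

theorem measurable_derivT : Measurable D.derivT :=
  (D.measurable_h.comp measurable_snd).add (measurable_primitive_fst D.measurable_k)

theorem measurable_derivX : Measurable D.derivX :=
  (D.measurable_g.comp measurable_fst).add (measurable_primitive_snd D.measurable_k)

end L2Densities

/-! ### The Ŵ-norm as an L² norm of densities. -/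

theorem derivWithin_eq_of_hasDerivAt {a b x d : ℝ} {f f' : ℝ → ℝ} (hab : a < b)
    (hx : x ∈ Icc a b)
    (h : ∀ y ∈ Icc a b, f y = f' y) (hd : HasDerivAt f' d x) :
    derivWithin f (Icc a b) x = d :=
  (hd.hasDerivWithinAt.congr h (h x hx)).derivWithin (uniqueDiffOn_Icc hab _ hx)

theorem L2Densities.ae_dt_eq {T : ℝ} (D : L2Densities T) {f : ℝ × ℝ → ℝ}
    (hf : ∀ p ∈ rect T, f p = D.toFun p) :
    ∀ᵐ t : ℝ, t ∈ Ioo 0 T → ∀ x ∈ Icc (0 : ℝ) 1, dt T f (x, t) = D.derivT (x, t) := by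
  filter_upwards [D.ae_hasDerivAt_toFun_snd] with t ht htm x hx
  exact derivWithin_eq_of_hasDerivAt (htm.1.trans htm.2) (Ioo_subset_Icc_self htm)
    (fun s hs => hf (x, s) ⟨hx, hs⟩) (ht x)

theorem L2Densities.innerWHat_self {T : ℝ} (hT : 0 < T) (D : L2Densities T) {f : ℝ × ℝ → ℝ}
    (hf : ∀ p ∈ rect T, f p = D.toFun p) :
    innerWHat T f f = (∫ t in (0 : ℝ)..T, D.h t ^ 2)
      + (D.c ^ 2 + ∫ x in (0 : ℝ)..1, D.g x ^ 2)
      + ∫ x in (0 : ℝ)..1, ∫ t in (0 : ℝ)..T, D.k (x, t) ^ 2 := by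
  have z1 : (0 : ℝ) ∈ Icc (0 : ℝ) 1 := ⟨le_rfl, zero_le_one⟩
  have zT : (0 : ℝ) ∈ Icc 0 T := ⟨le_rfl, hT.le⟩
  unfold innerWHat innerW21
  congr 1
  · congr 1
    · refine integral_congr_Ioo hT.le ?_
      filter_upwards [D.ae_dt_eq hf] with t ht htm
      rw [ht htm 0 z1]
      simp [L2Densities.derivT, sq]
    · congr 1
      · simp only
        rw [hf (0, 0) ⟨z1, zT⟩]
        simp [L2Densities.toFun, sq]
      · refine integral_congr_Ioo zero_le_one ?_
        filter_upwards [D.ae_hasDerivAt_toFun_fst] with x hx hxm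
        rw [derivWithin_eq_of_hasDerivAt zero_lt_one (Ioo_subset_Icc_self hxm)
          (fun y hy => hf (y, 0) ⟨hy, zT⟩) hx, sq]
  · refine integral_integral_congr_Ioo (F := fun p => dx (dt T f) p * dx (dt T f) p)
      (G := fun p => D.k p ^ 2) hT.le ?_
    filter_upwards [D.ae_hasDerivAt_derivT] with x hx
    filter_upwards [hx, D.ae_dt_eq hf] with t ht ht2 hxm htm
    -- `ht2` identifies ∂_t f on the whole slice of height t, which is what allows the identity to
    -- be differentiated in x.
    have : dx (dt T f) (x, t) = D.k (x, t) :=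
      derivWithin_eq_of_hasDerivAt zero_lt_one (Ioo_subset_Icc_self hxm)
        (fun y hy => ht2 htm y hy) ht
    simp only [this, sq]

/-- Square integrable densities can be normalized. -/
theorem HasDensities.exists_L2Densities {T : ℝ} {f : ℝ × ℝ → ℝ} {c : ℝ} {g h : ℝ → ℝ}
    {k : ℝ × ℝ → ℝ} (H : HasDensities T f c g h k)
    (hg : MemLp g 2 (volume.restrict (Icc 0 1))) (hh : MemLp h 2 (volume.restrict (Icc 0 T)))
    (hk : MemLp k 2 (volume.restrict (rect T))) :
    ∃ D : L2Densities T, D.c = c ∧ (∀ᵐ x, x ∈ Icc (0 : ℝ) 1 → D.g x = g x) ∧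
      (∀ᵐ t, t ∈ Icc 0 T → D.h t = h t) ∧ (∀ᵐ p, p ∈ rect T → D.k p = k p) ∧
      ∀ p ∈ rect T, f p = D.toFun p := by
  obtain ⟨g', mg, g0, g2, ge⟩ := exists_measurable_indicator measurableSet_Icc hg
  obtain ⟨h', mh, h0, h2, he⟩ := exists_measurable_indicator measurableSet_Icc hh
  obtain ⟨k', mk, k0, k2, kl, kr, ke⟩ := exists_measurable_slices hk
  let D : L2Densities T := ⟨c, g', h', k', mg, mh, mk, g0, h0, k0, g2, h2, k2, kl, kr⟩
  refine ⟨D, rfl, ge, he, ke, ?_⟩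
  rintro ⟨x, t⟩ ⟨hx, ht⟩
  simp only at hx ht
  rw [H.eq_on x hx t ht]
  have e1 : ∫ y in (0 : ℝ)..x, D.g y = ∫ y in (0 : ℝ)..x, g y := by
    refine integral_congr_Ioo hx.1 ?_
    filter_upwards [ge] with y hy hm using hy ⟨hm.1.le, hm.2.le.trans hx.2⟩
  have e2 : ∫ s in (0 : ℝ)..t, D.h s = ∫ s in (0 : ℝ)..t, h s := by
    refine integral_congr_Ioo ht.1 ?_
    filter_upwards [he] with y hy hm using hy ⟨hm.1.le, hm.2.le.trans ht.2⟩
  have e3 : ∫ y in (0 : ℝ)..x, ∫ s in (0 : ℝ)..t, D.k (y, s)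
      = ∫ y in (0 : ℝ)..x, ∫ s in (0 : ℝ)..t, k (y, s) := by
    rw [integral_integral_eq_setIntegral D.integrable_k.integrableOn hx ht,
      integral_integral_eq_setIntegral H.integrable_xt hx ht]
    refine setIntegral_congr_ae (measurableSet_Ioc.prod measurableSet_Ioc) ?_
    filter_upwards [ke] with p hp hm
    exact hp ⟨⟨hm.1.1.le, hm.1.2.trans hx.2⟩, ⟨hm.2.1.le, hm.2.2.trans ht.2⟩⟩
  simp only [L2Densities.toFun, e1, e2, e3]
  rfl

/-- With this formula the upper bound for Lu involves only its densities and no pointwise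
derivatives of Lu. -/
theorem HasDensities.innerWHat_self {T : ℝ} (hT : 0 < T) {f : ℝ × ℝ → ℝ} {c : ℝ} {g h : ℝ → ℝ}
    {k : ℝ × ℝ → ℝ} (H : HasDensities T f c g h k)
    (hg : MemLp g 2 (volume.restrict (Icc 0 1))) (hh : MemLp h 2 (volume.restrict (Icc 0 T)))
    (hk : MemLp k 2 (volume.restrict (rect T))) :
    innerWHat T f f = (∫ t in (0 : ℝ)..T, h t ^ 2) + (c ^ 2 + ∫ x in (0 : ℝ)..1, g x ^ 2)
      + ∫ x in (0 : ℝ)..1, ∫ t in (0 : ℝ)..T, k (x, t) ^ 2 := by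
  obtain ⟨D, ec, eg, eh, ek, ef⟩ := H.exists_L2Densities hg hh hk
  rw [D.innerWHat_self hT ef, ec]
  congr 1
  · congr 1
    · refine integral_congr_Ioo hT.le ?_
      filter_upwards [eh] with t ht htm
      rw [ht (Ioo_subset_Icc_self htm)]
    · congr 1
      refine integral_congr_Ioo zero_le_one ?_
      filter_upwards [eg] with t ht htm
      rw [ht (Ioo_subset_Icc_self htm)]
  · refine integral_integral_congr_Ioo (F := fun p => D.k p ^ 2) (G := fun p => k p ^ 2) hT.le ?_
    filter_upwards [Measure.ae_ae_of_ae_prod ek] with x hx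
    filter_upwards [hx] with t ht hxm htm
    simp only [ht ⟨Ioo_subset_Icc_self hxm, Ioo_subset_Icc_self htm⟩]

/-! ### Domination on products, primitives in time, and the two-point problem. -/

theorem integrableOn_prod_of_abs_le_snd {A B : Set ℝ} (hA : MeasurableSet A)
    (hB : MeasurableSet B) (hA' : volume A ≠ ⊤) {F : ℝ × ℝ → ℝ} (hF : Measurable F)
    {R : ℝ → ℝ} (hR : Integrable R) (h : ∀ y ∈ A, ∀ s ∈ B, |F (y, s)| ≤ R s) :
    IntegrableOn F (A ×ˢ B) := by
  have : Fact (volume A < ⊤) := ⟨hA'.lt_top⟩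
  have h1 : Integrable (fun p : ℝ × ℝ => R p.2)
      ((volume.restrict A).prod (volume.restrict B)) := hR.integrableOn.comp_snd _
  rw [Measure.prod_restrict] at h1
  refine Integrable.mono' h1 hF.aestronglyMeasurable ?_
  exact (ae_restrict_iff' (hA.prod hB)).2 (ae_of_all _ fun p hp => h _ hp.1 _ hp.2)

theorem integrableOn_prod_of_abs_le_fst {A B : Set ℝ} (hA : MeasurableSet A)
    (hB : MeasurableSet B) (hB' : volume B ≠ ⊤) {F : ℝ × ℝ → ℝ} (hF : Measurable F)
    {S : ℝ → ℝ} (hS : Integrable S) (h : ∀ y ∈ A, ∀ s ∈ B, |F (y, s)| ≤ S y) :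
    IntegrableOn F (A ×ˢ B) := by
  have : Fact (volume B < ⊤) := ⟨hB'.lt_top⟩
  have h1 : Integrable (fun p : ℝ × ℝ => S p.1)
      ((volume.restrict A).prod (volume.restrict B)) := hS.integrableOn.comp_fst _
  rw [Measure.prod_restrict] at h1
  refine Integrable.mono' h1 hF.aestronglyMeasurable ?_
  exact (ae_restrict_iff' (hA.prod hB)).2 (ae_of_all _ fun p hp => h _ hp.1 _ hp.2)

/-- The primitive in time. -/
def timeInt (F : ℝ × ℝ → ℝ) (p : ℝ × ℝ) : ℝ := ∫ s in (0 : ℝ)..p.2, F (p.1, s)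

theorem continuous_timeInt {F : ℝ × ℝ → ℝ} (hF : Continuous F) : Continuous (timeInt F) :=
  intervalIntegral.continuous_parametric_intervalIntegral_of_continuous
    (f := fun (p : ℝ × ℝ) s => F (p.1, s)) (by fun_prop) continuous_snd

theorem hasDerivAt_intervalIntegral {f : ℝ → ℝ} (hf : Continuous f) (a t : ℝ) :
    HasDerivAt (fun t => ∫ s in a..t, f s) (f t) t :=
  intervalIntegral.integral_hasDerivAt_right (hf.intervalIntegrable _ _)
    hf.aestronglyMeasurable.stronglyMeasurableAtFilter hf.continuousAt

theorem hasDerivAt_timeInt_snd {F : ℝ × ℝ → ℝ} (hF : Continuous F) (p : ℝ × ℝ) :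
    HasDerivAt (fun t => timeInt F (p.1, t)) (F p) p.2 :=
  hasDerivAt_intervalIntegral (f := fun s => F (p.1, s)) (by fun_prop) 0 p.2

/-- F is written as a primitive of F' in x; Fubini makes the time integral a primitive in x as well,
and the fundamental theorem of calculus applies. -/
theorem hasDerivAt_timeInt_fst {F F' : ℝ × ℝ → ℝ} (hF : Continuous F) (hF' : Continuous F')
    (h : ∀ p : ℝ × ℝ, HasDerivAt (fun y => F (y, p.2)) (F' p) p.1) (p : ℝ × ℝ) :
    HasDerivAt (fun y => timeInt F (y, p.2)) (timeInt F' p) p.1 := by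
  have e : ∀ x s, F (x, s) = F (0, s) + ∫ y in (0 : ℝ)..x, F' (y, s) := by
    intro x s
    rw [intervalIntegral.integral_eq_sub_of_hasDerivAt (f := fun y => F (y, s))
      (fun y _ => h (y, s)) (Continuous.intervalIntegrable (by fun_prop) _ _)]
    ring
  have hc : Continuous fun q : ℝ × ℝ => ∫ y in (0 : ℝ)..q.1, F' (y, q.2) :=
    intervalIntegral.continuous_parametric_intervalIntegral_of_continuous
      (f := fun (q : ℝ × ℝ) y => F' (y, q.2)) (by fun_prop) continuous_fst
  have e2 : ∀ x, timeInt F (x, p.2)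
      = timeInt F (0, p.2) + ∫ y in (0 : ℝ)..x, timeInt F' (y, p.2) := by
    intro x
    unfold timeInt
    rw [intervalIntegral.integral_congr (fun s _ => e x s), intervalIntegral.integral_add
      (Continuous.intervalIntegrable (by fun_prop) _ _)
      (Continuous.intervalIntegrable (by fun_prop) _ _),
      intervalIntegral_intervalIntegral_swap (F := fun s y => F' (y, s))]
    have : Continuous (Function.uncurry fun s y => F' (y, s)) := by
      unfold Function.uncurry; fun_prop
    exact (this.continuousOn.integrableOn_compact
      (isCompact_uIcc.prod isCompact_uIcc)).mono_set
        (prod_mono uIoc_subset_uIcc uIoc_subset_uIcc)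
  have hcJ := continuous_timeInt hF'
  exact ((hasDerivAt_intervalIntegral (f := fun y => timeInt F' (y, p.2)) (by fun_prop) 0
    p.1).const_add (timeInt F (0, p.2))).congr_of_eventuallyEq (Eventually.of_forall e2)

theorem dx_of_eq {T : ℝ} {f F F' : ℝ × ℝ → ℝ} (hf : ∀ p ∈ rect T, f p = F p)
    (h : ∀ p : ℝ × ℝ, HasDerivAt (fun y => F (y, p.2)) (F' p) p.1) :
    DiffX T f ∧ ∀ p ∈ rect T, dx f p = F' p :=
  ⟨fun p hp => (h p).differentiableAt.differentiableWithinAt.congr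
    (fun y hy => hf (y, p.2) ⟨hy, hp.2⟩) (hf p hp),
    fun p hp => derivWithin_eq_of_hasDerivAt zero_lt_one hp.1
      (fun y hy => hf (y, p.2) ⟨hy, hp.2⟩) (h p)⟩

theorem dt_of_eq {T : ℝ} (hT : 0 < T) {f F F' : ℝ × ℝ → ℝ} (hf : ∀ p ∈ rect T, f p = F p)
    (h : ∀ p : ℝ × ℝ, HasDerivAt (fun s => F (p.1, s)) (F' p) p.2) :
    ∀ p ∈ rect T, dt T f p = F' p :=
  fun p hp => derivWithin_eq_of_hasDerivAt hT hp.2 (fun s hs => hf (p.1, s) ⟨hp.1, hs⟩) (h p)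

theorem eq_add_integral_of_hasDerivWithinAt {a : ℝ} {f f' : ℝ → ℝ}
    (h : ∀ x ∈ Icc 0 a, HasDerivWithinAt f (f' x) (Icc 0 a) x) (hc : ContinuousOn f' (Icc 0 a))
    {x : ℝ} (hx : x ∈ Icc 0 a) : f x = f 0 + ∫ y in (0 : ℝ)..x, f' y := by
  have sub : Icc 0 x ⊆ Icc 0 a := Icc_subset_Icc_right hx.2
  rw [intervalIntegral.integral_eq_sub_of_hasDerivAt_of_le hx.1
    (fun y hy => ((h y (sub hy)).continuousWithinAt).mono sub)
    (fun y hy => (h y (sub (Ioo_subset_Icc_self hy))).hasDerivAt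
      (Icc_mem_nhds hy.1 (hy.2.trans_le hx.2)))
    ((hc.mono sub).intervalIntegrable_of_Icc hx.1)]
  ring

/-- The solution of `f'' = φ` with zero boundary values. -/
theorem eq_of_second_deriv {f f' φ : ℝ → ℝ}
    (h : ∀ x ∈ Icc (0 : ℝ) 1, HasDerivWithinAt f (f' x) (Icc 0 1) x)
    (h' : ∀ x ∈ Icc (0 : ℝ) 1, HasDerivWithinAt f' (φ x) (Icc 0 1) x)
    (hφ : ContinuousOn φ (Icc 0 1)) (h0 : f 0 = 0) (h1 : f 1 = 0) :
    ∀ x ∈ Icc (0 : ℝ) 1,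
      f x = ∫ y in (0 : ℝ)..x, f' y ∧
      f' x = (∫ y in (0 : ℝ)..x, φ y) - ∫ y in (0 : ℝ)..1, (1 - y) * φ y := by
  have c' : ContinuousOn f' (Icc 0 1) := fun x hx => (h' x hx).continuousWithinAt
  have m1 : (1 : ℝ) ∈ Icc (0 : ℝ) 1 := ⟨zero_le_one, le_rfl⟩
  -- In the derivative of f + (1-x) f' the f' terms cancel. Integration over [0,1] with f(0) = f(1)
  -- = 0 yields f'(0) = -∫(1-y)φ.
  have e : ∀ x ∈ Icc (0 : ℝ) 1,
      HasDerivWithinAt (fun x => f x + (1 - x) * f' x) ((1 - x) * φ x) (Icc 0 1) x := by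
    intro x hx
    have := (h x hx).add ((((hasDerivWithinAt_id x _).const_sub 1)).mul (h' x hx))
    refine this.congr_deriv ?_
    simp
  have e2 := eq_add_integral_of_hasDerivWithinAt e (by fun_prop) m1
  intro x hx
  have e3 := eq_add_integral_of_hasDerivWithinAt h c' hx
  have e4 := eq_add_integral_of_hasDerivWithinAt h' hφ hx
  simp only [h0, h1] at e2 e3
  constructor <;> linarith

/-! ### Densities of u_tt and u_xx. -/

namespace L2Densities

variable {T : ℝ} (D : L2Densities T)

/-- If `D` represents `∂⁴u/∂x²∂t²`, this is `∂³u/∂x∂t²`. -/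
def accelX (p : ℝ × ℝ) : ℝ :=
  (∫ y in (0 : ℝ)..p.1, D.toFun (y, p.2)) - ∫ y in (0 : ℝ)..1, (1 - y) * D.toFun (y, p.2)

/-- If `D` represents `∂⁴u/∂x²∂t²`, this is `∂²u/∂t²`. -/
def accel (p : ℝ × ℝ) : ℝ := ∫ y in (0 : ℝ)..p.1, D.accelX (y, p.2)

/-- The derivative of `accelX` in time. -/
def accelXT (p : ℝ × ℝ) : ℝ :=
  (∫ y in (0 : ℝ)..p.1, D.derivT (y, p.2)) - ∫ y in (0 : ℝ)..1, (1 - y) * D.derivT (y, p.2)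

theorem continuous_accelX : Continuous D.accelX := by
  have := D.continuous_toFun
  refine Continuous.sub ?_ ?_
  · exact intervalIntegral.continuous_parametric_intervalIntegral_of_continuous
      (f := fun (q : ℝ × ℝ) y => D.toFun (y, q.2)) (by fun_prop) continuous_fst
  · exact intervalIntegral.continuous_parametric_intervalIntegral_of_continuous
      (f := fun (q : ℝ × ℝ) y => (1 - y) * D.toFun (y, q.2)) (by fun_prop) continuous_const

theorem continuous_accel : Continuous D.accel := by
  have := D.continuous_accelX
  exact intervalIntegral.continuous_parametric_intervalIntegral_of_continuous
    (f := fun (q : ℝ × ℝ) y => D.accelX (y, q.2)) (by fun_prop) continuous_fst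

theorem hasDerivAt_accelX (p : ℝ × ℝ) :
    HasDerivAt (fun y => D.accelX (y, p.2)) (D.toFun p) p.1 := by
  have := D.continuous_toFun
  exact (hasDerivAt_intervalIntegral (f := fun y => D.toFun (y, p.2)) (by fun_prop) 0
    p.1).sub_const (∫ y in (0 : ℝ)..1, (1 - y) * D.toFun (y, p.2))

theorem hasDerivAt_accel (p : ℝ × ℝ) :
    HasDerivAt (fun y => D.accel (y, p.2)) (D.accelX p) p.1 := by
  have := D.continuous_accelX
  exact hasDerivAt_intervalIntegral (f := fun y => D.accelX (y, p.2)) (by fun_prop) 0 p.1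

theorem hasDerivAt_accelXT (p : ℝ × ℝ) :
    HasDerivAt (fun y => D.accelXT (y, p.2)) (D.derivT p) p.1 :=
  (hasDerivAt_intervalIntegral (D.continuous_derivT_fst p.2) 0 p.1).sub_const
    (∫ y in (0 : ℝ)..1, (1 - y) * D.derivT (y, p.2))

theorem measurable_accelXT : Measurable D.accelXT := by
  refine (measurable_primitive_fst D.measurable_derivT).sub ?_
  have h : Measurable fun p : ℝ × ℝ => (1 - p.1) * D.derivT p :=
    (measurable_const.sub measurable_fst).mul D.measurable_derivT
  exact (measurable_primitive_fst h).comp (measurable_const.prodMk measurable_snd)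

/-- A bound of `derivT` uniform in `x`. -/
def boundT (s : ℝ) : ℝ := |D.h s| + ∫ y, |D.k (y, s)|

/-- A bound of `derivX` uniform in `t`. -/
def boundX (y : ℝ) : ℝ := |D.g y| + ∫ s, |D.k (y, s)|

theorem abs_derivT_le (p : ℝ × ℝ) : |D.derivT p| ≤ D.boundT p.2 :=
  (abs_add_le _ _).trans
    (add_le_add_right (abs_intervalIntegral_le (D.integrable_k_right p.2) 0 p.1) _)

theorem abs_derivX_le (p : ℝ × ℝ) : |D.derivX p| ≤ D.boundX p.1 :=
  (abs_add_le _ _).trans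
    (add_le_add_right (abs_intervalIntegral_le (D.integrable_k_left p.1) 0 p.2) _)

theorem boundT_nonneg (s : ℝ) : 0 ≤ D.boundT s := (abs_nonneg _).trans (D.abs_derivT_le (0, s))

theorem boundX_nonneg (y : ℝ) : 0 ≤ D.boundX y := (abs_nonneg _).trans (D.abs_derivX_le (y, 0))

theorem integrable_boundT : Integrable D.boundT :=
  D.integrable_h.abs.add (Integrable.integral_norm_prod_right (μ := volume) (ν := volume)
    D.integrable_k)

theorem integrable_boundX : Integrable D.boundX :=
  D.integrable_g.abs.add (Integrable.integral_norm_prod_left (μ := volume) (ν := volume)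
    D.integrable_k)

theorem boundT_sq_le (s : ℝ) :
    D.boundT s ^ 2 ≤ 2 * D.h s ^ 2 + 2 * ∫ y, D.k (y, s) ^ 2 := by
  have := sq_integral_abs_le zero_le_one (D.k_off_right s) (D.integrable_k_right s)
    (D.integrable_k_sq_right s)
  unfold boundT
  nlinarith [sq_nonneg (|D.h s| - ∫ y, |D.k (y, s)|), sq_abs (D.h s)]

theorem boundX_sq_le (hT : 0 ≤ T) (y : ℝ) :
    D.boundX y ^ 2 ≤ 2 * D.g y ^ 2 + 2 * T * ∫ s, D.k (y, s) ^ 2 := by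
  have := sq_integral_abs_le hT (D.k_off_left y) (D.integrable_k_left y)
    (D.integrable_k_sq_left y)
  unfold boundX
  nlinarith [sq_nonneg (|D.g y| - ∫ s, |D.k (y, s)|), sq_abs (D.g y)]

theorem integrable_boundT_sq : Integrable fun s => D.boundT s ^ 2 := by
  refine Integrable.mono' ((D.integrable_h_sq.const_mul 2).add
    ((Integrable.integral_prod_right (μ := volume) (ν := volume) D.integrable_k_sq).const_mul 2))
    (D.integrable_boundT.aestronglyMeasurable.pow 2) (ae_of_all _ fun s => ?_)
  rw [Real.norm_of_nonneg (sq_nonneg _)]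
  exact D.boundT_sq_le s

theorem integrable_boundX_sq (hT : 0 ≤ T) : Integrable fun y => D.boundX y ^ 2 := by
  refine Integrable.mono' ((D.integrable_g_sq.const_mul 2).add
    ((Integrable.integral_prod_left (μ := volume) (ν := volume)
      D.integrable_k_sq).const_mul (2 * T)))
    (D.integrable_boundX.aestronglyMeasurable.pow 2) (ae_of_all _ fun s => ?_)
  rw [Real.norm_of_nonneg (sq_nonneg _)]
  exact D.boundX_sq_le hT s

theorem integral_boundT_sq_le :
    ∫ s, D.boundT s ^ 2 ≤ 2 * (∫ s, D.h s ^ 2) + 2 * ∫ p, D.k p ^ 2 := by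
  have i1 := Integrable.integral_prod_right (μ := volume) (ν := volume) D.integrable_k_sq
  refine (integral_mono D.integrable_boundT_sq ((D.integrable_h_sq.const_mul 2).add
    (i1.const_mul 2)) D.boundT_sq_le).trans_eq ?_
  simp only [Pi.add_apply]
  rw [integral_add (D.integrable_h_sq.const_mul 2) (i1.const_mul 2), integral_const_mul,
    integral_const_mul, Measure.volume_eq_prod, integral_prod_symm _ D.integrable_k_sq]

theorem integral_boundX_sq_le (hT : 0 ≤ T) :
    ∫ y, D.boundX y ^ 2 ≤ 2 * (∫ y, D.g y ^ 2) + 2 * T * ∫ p, D.k p ^ 2 := by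
  have i1 := Integrable.integral_prod_left (μ := volume) (ν := volume) D.integrable_k_sq
  refine (integral_mono (D.integrable_boundX_sq hT) ((D.integrable_g_sq.const_mul 2).add
    (i1.const_mul (2 * T))) (D.boundX_sq_le hT)).trans_eq ?_
  simp only [Pi.add_apply]
  rw [integral_add (D.integrable_g_sq.const_mul 2) (i1.const_mul (2 * T)), integral_const_mul,
    integral_const_mul, Measure.volume_eq_prod, integral_prod _ D.integrable_k_sq]

/-- Meant for the weights 1 and 1 - z, which occur in `accelX`. Since `derivT` is merely measurable,
Fubini rests on the majorant `boundT`. -/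
theorem integral_weight_toFun {a : ℝ → ℝ} (ha : Continuous a) {y : ℝ} (hy : y ∈ Icc (0 : ℝ) 1)
    (ha1 : ∀ z ∈ Icc (0 : ℝ) 1, |a z| ≤ 1) (t : ℝ) :
    ∫ z in (0 : ℝ)..y, a z * D.toFun (z, t) = (∫ z in (0 : ℝ)..y, a z * D.toFun (z, 0))
      + ∫ s in (0 : ℝ)..t, ∫ z in (0 : ℝ)..y, a z * D.derivT (z, s) := by
  have hc := D.continuous_toFun
  have e : ∀ z, ∫ s in (0 : ℝ)..t, a z * D.derivT (z, s)
      = a z * D.toFun (z, t) - a z * D.toFun (z, 0) := by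
    intro z
    rw [intervalIntegral.integral_const_mul, D.toFun_eq_add_integral_derivT z t]
    ring
  rw [← intervalIntegral_intervalIntegral_swap (F := fun z s => a z * D.derivT (z, s))]
  · simp only [e]
    rw [intervalIntegral.integral_sub (Continuous.intervalIntegrable (by fun_prop) _ _)
      (Continuous.intervalIntegrable (by fun_prop) _ _)]
    ring
  · refine integrableOn_prod_of_abs_le_snd measurableSet_uIoc measurableSet_uIoc (by simp)
      ((ha.measurable.comp measurable_fst).mul D.measurable_derivT) D.integrable_boundT
      fun z hz s _ => ?_
    rw [uIoc_of_le hy.1] at hz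
    have h1 := ha1 z ⟨hz.1.le, hz.2.trans hy.2⟩
    simp only [Function.uncurry_apply_pair, abs_mul]
    exact (mul_le_of_le_one_left (abs_nonneg _) h1).trans (D.abs_derivT_le (z, s))

theorem abs_integral_weight_derivT_le {a : ℝ → ℝ} {y : ℝ} (hy : y ∈ Icc (0 : ℝ) 1)
    (ha1 : ∀ z ∈ Icc (0 : ℝ) 1, |a z| ≤ 1) (s : ℝ) :
    |∫ z in (0 : ℝ)..y, a z * D.derivT (z, s)| ≤ D.boundT s := by
  have := intervalIntegral.norm_integral_le_of_norm_le_const (a := 0) (b := y)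
    (f := fun z => a z * D.derivT (z, s)) (C := D.boundT s) fun z hz => by
      rw [uIoc_of_le hy.1] at hz
      rw [norm_mul]
      exact (mul_le_of_le_one_left (abs_nonneg _) (ha1 z ⟨hz.1.le, hz.2.trans hy.2⟩)).trans
        (D.abs_derivT_le (z, s))
  refine this.trans (mul_le_of_le_one_right (D.boundT_nonneg s) ?_)
  rw [sub_zero, abs_of_nonneg hy.1]
  exact hy.2

theorem abs_one_sub_le : ∀ z ∈ Icc (0 : ℝ) 1, |1 - z| ≤ 1 := fun z hz =>
  abs_le.2 ⟨by linarith [hz.2], by linarith [hz.1]⟩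

theorem abs_accelXT_le {p : ℝ × ℝ} (hp : p.1 ∈ Icc (0 : ℝ) 1) :
    |D.accelXT p| ≤ 2 * D.boundT p.2 := by
  have h1 := D.abs_integral_weight_derivT_le (a := fun _ => 1) hp (by simp) p.2
  have h2 := D.abs_integral_weight_derivT_le (a := fun z => 1 - z)
    (right_mem_Icc.2 zero_le_one) abs_one_sub_le p.2
  simp only [one_mul] at h1
  exact (abs_sub _ _).trans (by linarith)

theorem accelX_eq {x : ℝ} (hx : x ∈ Icc (0 : ℝ) 1) (t : ℝ) :
    D.accelX (x, t) = D.accelX (x, 0) + ∫ s in (0 : ℝ)..t, D.accelXT (x, s) := by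
  have h1 := D.integral_weight_toFun (a := fun _ => 1) continuous_const hx (by simp) t
  have h2 := D.integral_weight_toFun (a := fun z => 1 - z) (by fun_prop)
    (right_mem_Icc.2 zero_le_one) abs_one_sub_le t
  have i1 : Integrable fun s => ∫ z in (0 : ℝ)..x, D.derivT (z, s) :=
    Integrable.mono' D.integrable_boundT
      ((measurable_primitive_fst D.measurable_derivT).comp
        (measurable_prodMk_left (x := x))).aestronglyMeasurable
      (ae_of_all _ fun s => by
        simpa using D.abs_integral_weight_derivT_le (a := fun _ => 1) hx (by simp) s)
  have hm : Measurable fun p : ℝ × ℝ => (1 - p.1) * D.derivT p :=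
    (measurable_const.sub measurable_fst).mul D.measurable_derivT
  have i2 : Integrable fun s => ∫ z in (0 : ℝ)..1, (1 - z) * D.derivT (z, s) :=
    Integrable.mono' D.integrable_boundT
      ((measurable_primitive_fst hm).comp
        (measurable_prodMk_left (x := (1 : ℝ)))).aestronglyMeasurable
      (ae_of_all _ fun s => D.abs_integral_weight_derivT_le (a := fun z => 1 - z)
        (right_mem_Icc.2 zero_le_one) abs_one_sub_le s)
  simp only [one_mul] at h1
  simp only [accelX, accelXT]
  rw [intervalIntegral.integral_sub i1.intervalIntegrable i2.intervalIntegrable, h1, h2]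
  ring

theorem memLp_accelXT : MemLp D.accelXT 2 (volume.restrict (rect T)) := by
  rw [memLp_two_iff_integrable_sq D.measurable_accelXT.aestronglyMeasurable]
  refine integrableOn_prod_of_abs_le_snd measurableSet_Icc measurableSet_Icc (by simp)
    (D.measurable_accelXT.pow_const 2) (D.integrable_boundT_sq.const_mul 4) fun y hy s _ => ?_
  have := D.abs_accelXT_le (p := (y, s)) hy
  rw [abs_of_nonneg (sq_nonneg _), ← sq_abs]
  nlinarith [abs_nonneg (D.accelXT (y, s))]

theorem memLp_accelX_zero : MemLp (fun x => D.accelX (x, 0)) 2 (volume.restrict (Icc 0 1)) := by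
  have hc : Continuous fun x => D.accelX (x, 0) := by
    have := D.continuous_accelX
    fun_prop
  rw [memLp_two_iff_integrable_sq hc.aestronglyMeasurable]
  exact (hc.pow 2).continuousOn.integrableOn_compact isCompact_Icc

theorem isFiniteMeasure_rect (T : ℝ) : IsFiniteMeasure (volume.restrict (rect T)) :=
  ⟨by simpa using (volume_rect_ne_top T).lt_top⟩

/-- `accel` vanishes on the edge x = 0, so its corner value and its density in t are zero. -/
theorem hasDensities_accel :
    HasDensities T D.accel 0 (fun x => D.accelX (x, 0)) (fun _ => 0) D.accelXT := by
  have := isFiniteMeasure_rect T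
  have hc := D.continuous_accelX
  refine ⟨D.memLp_accelX_zero.integrable (by norm_num), integrableOn_zero,
    D.memLp_accelXT.integrable (by norm_num), fun x hx t ht => ?_⟩
  have e : ∀ y ∈ uIcc 0 x, ∫ s in (0 : ℝ)..t, D.accelXT (y, s)
      = D.accelX (y, t) - D.accelX (y, 0) := by
    intro y hy
    rw [uIcc_of_le hx.1] at hy
    rw [D.accelX_eq ⟨hy.1, hy.2.trans hx.2⟩ t]
    ring
  rw [intervalIntegral.integral_congr e, intervalIntegral.integral_sub
    (Continuous.intervalIntegrable (by fun_prop) _ _)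
    (Continuous.intervalIntegrable (by fun_prop) _ _)]
  simp [accel]

theorem abs_timeInt_derivX_le {p : ℝ × ℝ} (hp : p.2 ∈ Icc 0 T) :
    |timeInt D.derivX p| ≤ T * D.boundX p.1 := by
  have := intervalIntegral.norm_integral_le_of_norm_le_const (a := 0) (b := p.2)
    (f := fun s => D.derivX (p.1, s)) (C := D.boundX p.1) fun s _ => D.abs_derivX_le (p.1, s)
  rw [sub_zero, abs_of_nonneg hp.1] at this
  refine this.trans ?_
  rw [mul_comm]
  exact mul_le_mul_of_nonneg_right hp.2 (D.boundX_nonneg _)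

theorem measurable_timeInt_derivX : Measurable (timeInt D.derivX) :=
  measurable_primitive_snd D.measurable_derivX

theorem memLp_timeInt_derivX (hT : 0 ≤ T) :
    MemLp (timeInt D.derivX) 2 (volume.restrict (rect T)) := by
  rw [memLp_two_iff_integrable_sq D.measurable_timeInt_derivX.aestronglyMeasurable]
  refine integrableOn_prod_of_abs_le_fst measurableSet_Icc measurableSet_Icc (by simp)
    (D.measurable_timeInt_derivX.pow_const 2) ((D.integrable_boundX_sq hT).const_mul (T ^ 2))
    fun y _ s hs => ?_
  have := D.abs_timeInt_derivX_le (p := (y, s)) hs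
  rw [abs_of_nonneg (sq_nonneg _), ← sq_abs, ← mul_pow]
  exact pow_le_pow_left₀ (abs_nonneg _) this 2

theorem timeInt_toFun_eq (x s : ℝ) :
    timeInt D.toFun (x, s)
      = timeInt D.toFun (0, s) + ∫ y in (0 : ℝ)..x, timeInt D.derivX (y, s) := by
  have hc := D.continuous_toFun
  have e : ∀ r, ∫ y in (0 : ℝ)..x, D.derivX (y, r) = D.toFun (x, r) - D.toFun (0, r) := by
    intro r
    rw [D.toFun_eq_add_integral_derivX x r]
    ring
  simp only [timeInt]
  rw [intervalIntegral_intervalIntegral_swap (F := fun y r => D.derivX (y, r))]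
  · simp only [e]
    rw [intervalIntegral.integral_sub (Continuous.intervalIntegrable (by fun_prop) _ _)
      (Continuous.intervalIntegrable (by fun_prop) _ _)]
    ring
  · exact integrableOn_prod_of_abs_le_fst measurableSet_uIoc measurableSet_uIoc (by simp)
      D.measurable_derivX D.integrable_boundX fun y _ s _ => D.abs_derivX_le (y, s)

/-- The double time primitive vanishes on t = 0, so its corner value and its density in x are zero.
-/
theorem hasDensities_timeInt_timeInt (hT : 0 ≤ T) :
    HasDensities T (timeInt (timeInt D.toFun)) 0 (fun _ => 0) (fun s => timeInt D.toFun (0, s))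
      (timeInt D.derivX) := by
  have := isFiniteMeasure_rect T
  have hc := continuous_timeInt D.continuous_toFun
  have hk : IntegrableOn (timeInt D.derivX) (rect T) :=
    (D.memLp_timeInt_derivX hT).integrable (by norm_num)
  refine ⟨integrableOn_zero, Continuous.integrableOn_Icc (by fun_prop), hk,
    fun x hx t ht => ?_⟩
  rw [intervalIntegral_intervalIntegral_swap (F := fun y s => timeInt D.derivX (y, s))]
  · have e : ∀ s, ∫ y in (0 : ℝ)..x, timeInt D.derivX (y, s)
        = timeInt D.toFun (x, s) - timeInt D.toFun (0, s) := by
      intro s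
      rw [D.timeInt_toFun_eq x s]
      ring
    simp only [e]
    rw [intervalIntegral.integral_sub (Continuous.intervalIntegrable (by fun_prop) _ _)
      (Continuous.intervalIntegrable (by fun_prop) _ _)]
    simp [timeInt]
  · rw [uIoc_of_le hx.1, uIoc_of_le ht.1]
    exact hk.mono_set (prod_mono (fun y hy => ⟨hy.1.le, hy.2.trans hx.2⟩)
      fun y hy => ⟨hy.1.le, hy.2.trans ht.2⟩)

end L2Densities

/-! ### Recovering u from its fourth mixed derivative. -/

theorem HasDensities.sub {T : ℝ} {f f' : ℝ × ℝ → ℝ} {c c' : ℝ} {g h g' h' : ℝ → ℝ}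
    {k k' : ℝ × ℝ → ℝ} (H : HasDensities T f c g h k) (H' : HasDensities T f' c' g' h' k') :
    HasDensities T (f - f') (c - c') (g - g') (h - h') (k - k') := by
  refine ⟨H.1.sub H'.1, H.2.sub H'.2, H.3.sub H'.3, fun x hx t ht => ?_⟩
  have sx : Ioc 0 x ⊆ Icc (0 : ℝ) 1 := fun y hy => ⟨hy.1.le, hy.2.trans hx.2⟩
  have st : Ioc 0 t ⊆ Icc (0 : ℝ) T := fun y hy => ⟨hy.1.le, hy.2.trans ht.2⟩
  have ix : ∀ {q : ℝ → ℝ}, IntegrableOn q (Icc 0 1) → IntervalIntegrable q volume 0 x :=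
    fun hq => (intervalIntegrable_iff_integrableOn_Ioc_of_le hx.1).2 (hq.mono_set sx)
  have it : ∀ {q : ℝ → ℝ}, IntegrableOn q (Icc 0 T) → IntervalIntegrable q volume 0 t :=
    fun hq => (intervalIntegrable_iff_integrableOn_Ioc_of_le ht.1).2 (hq.mono_set st)
  rw [integral_integral_eq_setIntegral (H.3.sub H'.3) hx ht]
  simp only [Pi.sub_apply]
  rw [integral_sub (H.3.mono_set (prod_mono sx st)) (H'.3.mono_set (prod_mono sx st)),
    ← integral_integral_eq_setIntegral H.3 hx ht, ← integral_integral_eq_setIntegral H'.3 hx ht,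
    intervalIntegral.integral_sub (ix H.1) (ix H'.1),
    intervalIntegral.integral_sub (it H.2) (it H'.2), H.eq_on x hx t ht, H'.eq_on x hx t ht]
  ring

theorem dt_eq_zero {T : ℝ} {u : ℝ × ℝ → ℝ} {x : ℝ} (h : ∀ t ∈ Icc 0 T, u (x, t) = 0) :
    ∀ t ∈ Icc 0 T, dt T u (x, t) = 0 := by
  intro t ht
  have := derivWithin_congr (𝕜 := ℝ) (f := fun _ : ℝ => (0 : ℝ)) (f₁ := fun s => u (x, s))
    (s := Icc 0 T) (x := t) (fun s hs => h s hs) (h t ht)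
  simpa [dt] using this

theorem DiffX.hasDerivWithinAt {T : ℝ} {u : ℝ × ℝ → ℝ} (hu : DiffX T u) {x t : ℝ}
    (hx : x ∈ Icc (0 : ℝ) 1) (ht : t ∈ Icc 0 T) :
    HasDerivWithinAt (fun y => u (y, t)) (dx u (x, t)) (Icc 0 1) x :=
  (hu (x, t) ⟨hx, ht⟩).hasDerivWithinAt

theorem DiffT.hasDerivWithinAt {T : ℝ} {u : ℝ × ℝ → ℝ} (hu : DiffT T u) {x t : ℝ}
    (hx : x ∈ Icc (0 : ℝ) 1) (ht : t ∈ Icc 0 T) :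
    HasDerivWithinAt (fun s => u (x, s)) (dt T u (x, t)) (Icc 0 T) t :=
  (hu (x, t) ⟨hx, ht⟩).hasDerivWithinAt

theorem DiffT.eq_timeInt {T : ℝ} {u F : ℝ × ℝ → ℝ} (hu : DiffT T u)
    (hF : Continuous F) (h : ∀ p ∈ rect T, dt T u p = F p)
    (h0 : ∀ x ∈ Icc (0 : ℝ) 1, u (x, 0) = 0) : ∀ p ∈ rect T, u p = timeInt F p := by
  rintro ⟨x, t⟩ ⟨hx, ht⟩
  have := eq_add_integral_of_hasDerivWithinAt (f := fun s => u (x, s)) (f' := fun s => F (x, s))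
    (fun s hs => h (x, s) ⟨hx, hs⟩ ▸ hu.hasDerivWithinAt hx hs) (by fun_prop) ht
  simp only [h0 x hx, zero_add] at this
  exact this

/-- An element `u` of `W(Ω)` is recovered from `∂⁴u/∂x²∂t²`. -/
theorem MemW.exists_densities {T : ℝ} {u : ℝ × ℝ → ℝ} (hu : MemW T u) :
    ∃ D : L2Densities T, (∀ p ∈ rect T, dt T (dt T u) p = D.accel p) ∧
      ∀ p ∈ rect T, u p = timeInt (timeInt D.accel) p := by
  obtain ⟨c, g, h, k, H, hg, hh, hk⟩ := hu.ac_xxtt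
  obtain ⟨D, -, -, -, -, hD⟩ := H.exists_L2Densities hg hh hk
  have hc := D.continuous_toFun
  have e : ∀ p ∈ rect T, dt T (dt T u) p = D.accel p := by
    rintro ⟨x, t⟩ ⟨hx, ht⟩
    -- Differentiating the conditions u(0,t) = u(1,t) = 0 twice in t gives the boundary values of
    -- u_tt, which thus solves the two-point problem with right-hand side φ(·,t).
    have key := eq_of_second_deriv (f := fun y => dt T (dt T u) (y, t))
      (f' := fun y => dx (dt T (dt T u)) (y, t)) (φ := fun y => D.toFun (y, t))
      (fun y hy => hu.diff_xtt.hasDerivWithinAt hy ht)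
      (fun y hy => hD (y, t) ⟨hy, ht⟩ ▸ hu.diff_xxtt.hasDerivWithinAt hy ht)
      (by fun_prop) (dt_eq_zero (dt_eq_zero hu.left) t ht)
      (dt_eq_zero (dt_eq_zero hu.right) t ht)
    refine (key x hx).1.trans (intervalIntegral.integral_congr fun y hy => ?_)
    rw [uIcc_of_le hx.1] at hy
    exact (key y ⟨hy.1, hy.2.trans hx.2⟩).2
  -- The two initial conditions allow integrating twice from t = 0 without additional terms.
  have e1 := hu.diff_tt.eq_timeInt D.continuous_accel e hu.initial_t
  exact ⟨D, e, hu.diff_t.eq_timeInt (continuous_timeInt D.continuous_accel) e1 hu.initial⟩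

theorem dx_of_eq_timeInt {T : ℝ} (D : L2Densities T) {u : ℝ × ℝ → ℝ}
    (h0 : ∀ p ∈ rect T, u p = timeInt (timeInt D.accel) p) :
    DiffX T u ∧ ∀ p ∈ rect T, dx u p = timeInt (timeInt D.accelX) p :=
  dx_of_eq h0 (hasDerivAt_timeInt_fst (continuous_timeInt D.continuous_accel)
    (continuous_timeInt D.continuous_accelX)
    (hasDerivAt_timeInt_fst D.continuous_accel D.continuous_accelX D.hasDerivAt_accel))

theorem dx_dx_of_eq_timeInt {T : ℝ} (D : L2Densities T) {u : ℝ × ℝ → ℝ}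
    (h0 : ∀ p ∈ rect T, u p = timeInt (timeInt D.accel) p) :
    DiffX T (dx u) ∧ ∀ p ∈ rect T, dx (dx u) p = timeInt (timeInt D.toFun) p :=
  dx_of_eq (dx_of_eq_timeInt D h0).2 (hasDerivAt_timeInt_fst
    (continuous_timeInt D.continuous_accelX) (continuous_timeInt D.continuous_toFun)
    (hasDerivAt_timeInt_fst D.continuous_accelX D.continuous_toFun D.hasDerivAt_accelX))

/-- Membership in W does not postulate that u_x and u_xx exist; the integral representation provides
them. The linearity of L uses this too. -/
theorem MemW.diffX {T : ℝ} {u : ℝ × ℝ → ℝ} (hu : MemW T u) : DiffX T u ∧ DiffX T (dx u) := by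
  obtain ⟨D, -, h0⟩ := hu.exists_densities
  exact ⟨(dx_of_eq_timeInt D h0).1, (dx_dx_of_eq_timeInt D h0).1⟩

/-! ### Lower bound for the W-norm. -/

theorem innerW23_self_nonneg (p : ℝ → ℝ) : 0 ≤ innerW23 p p := by
  have := intervalIntegral.integral_nonneg (f := fun x =>
    iteratedDerivWithin 3 p (Icc 0 1) x * iteratedDerivWithin 3 p (Icc 0 1) x) (μ := volume)
    (zero_le_one (α := ℝ)) fun x _ => mul_self_nonneg _
  unfold innerW23
  linarith [mul_self_nonneg (p 0), mul_self_nonneg (derivWithin p (Icc 0 1) 0),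
    mul_self_nonneg (derivWithin p (Icc 0 1) 1)]

namespace L2Densities

variable {T : ℝ} (D : L2Densities T)

theorem integral_g_sq : ∫ x in (0 : ℝ)..1, D.g x ^ 2 = ∫ x, D.g x ^ 2 :=
  (integral_eq_intervalIntegral zero_le_one fun x hx => by simp [D.g_off x hx]).symm

theorem integral_h_sq (hT : 0 ≤ T) : ∫ t in (0 : ℝ)..T, D.h t ^ 2 = ∫ t, D.h t ^ 2 :=
  (integral_eq_intervalIntegral hT fun x hx => by simp [D.h_off x hx]).symm

theorem integral_k_sq (hT : 0 ≤ T) :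
    ∫ x in (0 : ℝ)..1, ∫ t in (0 : ℝ)..T, D.k (x, t) ^ 2 = ∫ p, D.k p ^ 2 := by
  rw [Measure.volume_eq_prod, integral_prod _ D.integrable_k_sq, integral_eq_intervalIntegral
    zero_le_one fun x hx => by simp [D.k_off_right _ x hx]]
  refine intervalIntegral.integral_congr fun x _ => ?_
  exact (integral_eq_intervalIntegral hT fun t ht => by simp [D.k_off_left x t ht]).symm

/-- Only p'(0)² and ∫(p''')² are kept; p'' is φ(·,0), so p''' = g almost everywhere. -/
theorem le_innerW23 {p : ℝ → ℝ} (hp : ∀ x ∈ Icc (0 : ℝ) 1, p x = D.accel (x, 0)) :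
    D.accelX (0, 0) ^ 2 + ∫ x, D.g x ^ 2 ≤ innerW23 p p := by
  have d1 : ∀ x ∈ Icc (0 : ℝ) 1, derivWithin p (Icc 0 1) x = D.accelX (x, 0) := fun x hx =>
    derivWithin_eq_of_hasDerivAt zero_lt_one hx hp (D.hasDerivAt_accel (x, 0))
  have d2 : ∀ x ∈ Icc (0 : ℝ) 1,
      derivWithin (derivWithin p (Icc 0 1)) (Icc 0 1) x = D.toFun (x, 0) := fun x hx =>
    derivWithin_eq_of_hasDerivAt zero_lt_one hx d1 (D.hasDerivAt_accelX (x, 0))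
  have e : ∫ x in (0 : ℝ)..1,
      iteratedDerivWithin 3 p (Icc 0 1) x * iteratedDerivWithin 3 p (Icc 0 1) x
        = ∫ x, D.g x ^ 2 := by
    rw [← D.integral_g_sq]
    refine integral_congr_Ioo zero_le_one ?_
    filter_upwards [D.ae_hasDerivAt_toFun_fst] with x hx hxm
    rw [iteratedDerivWithin_succ, iteratedDerivWithin_succ, iteratedDerivWithin_succ,
      iteratedDerivWithin_zero, derivWithin_eq_of_hasDerivAt zero_lt_one
        (Ioo_subset_Icc_self hxm) d2 hx, sq]
  unfold innerW23
  rw [e, d1 0 (left_mem_Icc.2 zero_le_one)]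
  nlinarith [mul_self_nonneg (p 0), mul_self_nonneg (derivWithin p (Icc 0 1) 1)]

/-- `accel` is itself absolutely continuous with mixed density `accelXT`, so the x-independent null
set of `ae_dt_eq` is available for it after normalizing its densities. -/
theorem ae_dt_accel {f : ℝ × ℝ → ℝ} (hf : ∀ p ∈ rect T, f p = D.accel p) :
    ∀ᵐ t : ℝ, t ∈ Ioo 0 T → ∀ x ∈ Icc (0 : ℝ) 1,
      dt T f (x, t) = ∫ y in (0 : ℝ)..x, D.accelXT (y, t) := by
  obtain ⟨E, -, -, eh, ek, ef⟩ := D.hasDensities_accel.exists_L2Densities D.memLp_accelX_zero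
    MemLp.zero' D.memLp_accelXT
  -- The coordinates are swapped so that Fubini gives: for almost every t, for almost every y.
  have ek' : ∀ᵐ p : ℝ × ℝ ∂(volume.prod volume),
      p.swap ∈ rect T → E.k p.swap = D.accelXT p.swap :=
    (Measure.measurePreserving_swap (μ := (volume : Measure ℝ))
      (ν := (volume : Measure ℝ))).quasiMeasurePreserving.ae ek
  filter_upwards [E.ae_dt_eq (f := f) (fun p hp => (hf p hp).trans (ef p hp)), eh,
    Measure.ae_ae_of_ae_prod ek'] with t h1 h2 h3 ht x hx
  rw [h1 ht x hx, derivT]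
  simp only
  rw [h2 (Ioo_subset_Icc_self ht), zero_add]
  refine integral_congr_Ioo hx.1 ?_
  filter_upwards [h3] with y hy hym
  exact hy ⟨⟨hym.1.le, hym.2.le.trans hx.2⟩, Ioo_subset_Icc_self ht⟩

/-- With f = u_tt, for almost every t two x-derivatives of ∂_t f can be computed along the entire
slice, giving `accelXT` and `derivT`; the third is then k almost everywhere. -/
theorem integral_dx_dt_eq (hT : 0 < T) {f : ℝ × ℝ → ℝ} (hf : ∀ p ∈ rect T, f p = D.accel p) :
    ∫ x in (0 : ℝ)..1, ∫ t in (0 : ℝ)..T, dx (dx (dx (dt T f))) (x, t) *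
      dx (dx (dx (dt T f))) (x, t) = ∫ p, D.k p ^ 2 := by
  rw [← D.integral_k_sq hT.le]
  refine integral_integral_congr_Ioo
    (F := fun p => dx (dx (dx (dt T f))) p * dx (dx (dx (dt T f))) p)
    (G := fun p => D.k p ^ 2) hT.le ?_
  filter_upwards [D.ae_hasDerivAt_derivT] with x hx
  filter_upwards [hx, D.ae_dt_accel hf] with t ht ht2 hxm htm
  have hc : Continuous fun y => D.accelXT (y, t) :=
    continuous_iff_continuousAt.2 fun y => (D.hasDerivAt_accelXT (y, t)).continuousAt
  have d1 : ∀ y ∈ Icc (0 : ℝ) 1, dx (dt T f) (y, t) = D.accelXT (y, t) := fun y hy =>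
    derivWithin_eq_of_hasDerivAt zero_lt_one hy (ht2 htm) (hasDerivAt_intervalIntegral hc 0 y)
  have d2 : ∀ y ∈ Icc (0 : ℝ) 1, dx (dx (dt T f)) (y, t) = D.derivT (y, t) := fun y hy =>
    derivWithin_eq_of_hasDerivAt zero_lt_one hy d1 (D.hasDerivAt_accelXT (y, t))
  have d3 : dx (dx (dx (dt T f))) (x, t) = D.k (x, t) :=
    derivWithin_eq_of_hasDerivAt zero_lt_one (Ioo_subset_Icc_self hxm) d2 ht
  simp only [d3, sq]

/-- The density h comes from the edge term i = 2, `accelX (0, 0)` and g from the term j = 2, and k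
from the last integral. All other terms are nonnegative and are dropped. -/
theorem le_innerW (hT : 0 < T) {u : ℝ × ℝ → ℝ} (h2 : ∀ p ∈ rect T, dt T (dt T u) p = D.accel p)
    (h0 : ∀ p ∈ rect T, u p = timeInt (timeInt D.accel) p) :
    (∫ t, D.h t ^ 2) + (D.accelX (0, 0) ^ 2 + ∫ x, D.g x ^ 2) + ∫ p, D.k p ^ 2
      ≤ innerW T u u := by
  have z1 : (0 : ℝ) ∈ Icc (0 : ℝ) 1 := ⟨le_rfl, zero_le_one⟩
  have zT : (0 : ℝ) ∈ Icc 0 T := ⟨le_rfl, hT.le⟩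
  have i0 : ∀ i, 0 ≤ ∫ t in (0 : ℝ)..T,
      (dt T)^[3] (dx^[i] u) (0, t) * (dt T)^[3] (dx^[i] u) (0, t) := fun i =>
    intervalIntegral.integral_nonneg hT.le fun t _ => mul_self_nonneg _
  have e1 : ∀ p ∈ rect T, dt T (dt T (dx (dx u))) p = D.toFun p :=
    dt_of_eq hT (dt_of_eq hT (dx_dx_of_eq_timeInt D h0).2
      (hasDerivAt_timeInt_snd (continuous_timeInt D.continuous_toFun)))
      (hasDerivAt_timeInt_snd D.continuous_toFun)
  have i2 : ∫ t in (0 : ℝ)..T, (dt T)^[3] (dx^[2] u) (0, t) * (dt T)^[3] (dx^[2] u) (0, t)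
      = ∫ t, D.h t ^ 2 := by
    rw [← D.integral_h_sq hT.le]
    refine integral_congr_Ioo hT.le ?_
    filter_upwards [D.ae_dt_eq e1] with t ht htm
    have : (dt T)^[3] (dx^[2] u) (0, t) = D.h t := by
      refine (ht htm 0 z1).trans ?_
      simp [derivT]
    rw [this, sq]
  have j2 := D.le_innerW23 (p := fun x => (dt T)^[2] u (x, 0)) fun x hx => h2 (x, 0) ⟨hx, zT⟩
  have k2 : ∫ x in (0 : ℝ)..1, ∫ t in (0 : ℝ)..T,
      dx^[3] ((dt T)^[3] u) (x, t) * dx^[3] ((dt T)^[3] u) (x, t) = ∫ p, D.k p ^ 2 :=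
    D.integral_dx_dt_eq hT h2
  have j0 := innerW23_self_nonneg fun x => (dt T)^[0] u (x, 0)
  have j1 := innerW23_self_nonneg fun x => (dt T)^[1] u (x, 0)
  have i0' := i0 0
  have i1' := i0 1
  unfold innerW
  rw [Finset.sum_range_succ, Finset.sum_range_succ, Finset.sum_range_succ, Finset.sum_range_succ,
    Finset.sum_range_succ, Finset.sum_range_succ, Finset.sum_range_zero, Finset.sum_range_zero,
    i2, k2]
  linarith

end L2Densities

/-! ### Upper bound for the Ŵ-norm of Lu. -/

/-- No integrability of f is needed: otherwise its integral has the default value 0, and g is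
nonnegative. -/
theorem intervalIntegral_le_of_nonneg {a b : ℝ} (hab : a ≤ b) {f g : ℝ → ℝ}
    (h0 : ∀ x ∈ Icc a b, 0 ≤ f x) (hg : IntervalIntegrable g volume a b)
    (h : ∀ x ∈ Icc a b, f x ≤ g x) : ∫ x in a..b, f x ≤ ∫ x in a..b, g x := by
  rw [intervalIntegral.integral_of_le hab, intervalIntegral.integral_of_le hab]
  refine integral_mono_of_nonneg ?_ hg.1 ?_
  · exact (ae_restrict_iff' measurableSet_Ioc).2
      (ae_of_all _ fun x hx => h0 x (Ioc_subset_Icc_self hx))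
  · exact (ae_restrict_iff' measurableSet_Ioc).2
      (ae_of_all _ fun x hx => h x (Ioc_subset_Icc_self hx))

theorem intervalIntegral_le_mul_of_nonneg {a b C : ℝ} (hab : a ≤ b) {f : ℝ → ℝ}
    (h0 : ∀ x ∈ Icc a b, 0 ≤ f x) (h : ∀ x ∈ Icc a b, f x ≤ C) :
    ∫ x in a..b, f x ≤ (b - a) * C := by
  simpa using intervalIntegral_le_of_nonneg hab h0 (g := fun _ => C) (by simp) h

theorem intervalIntegral_le_integral {a b : ℝ} (hab : a ≤ b) {f : ℝ → ℝ} (hf : Integrable f)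
    (h0 : ∀ x, 0 ≤ f x) : ∫ x in a..b, f x ≤ ∫ x, f x := by
  rw [intervalIntegral.integral_of_le hab]
  exact setIntegral_le_integral hf (ae_of_all _ h0)

namespace L2Densities

variable {T : ℝ} (D : L2Densities T)

/-- The densities of `L u`, where `D` represents `∂⁴u/∂x²∂t²`. -/
theorem hasDensities_wave (hT : 0 ≤ T) :
    HasDensities T (D.accel - timeInt (timeInt D.toFun)) 0 (fun x => D.accelX (x, 0))
      (fun s => -timeInt D.toFun (0, s)) (D.accelXT - timeInt D.derivX) := by
  convert D.hasDensities_accel.sub (D.hasDensities_timeInt_timeInt hT) using 1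
  · simp
  · ext; simp
  · ext; simp

theorem memLp_wave_t : MemLp (fun s => -timeInt D.toFun (0, s)) 2 (volume.restrict (Icc 0 T)) := by
  have hc := continuous_timeInt D.continuous_toFun
  have hc' : Continuous fun s => -timeInt D.toFun (0, s) := by fun_prop
  rw [memLp_two_iff_integrable_sq hc'.aestronglyMeasurable]
  exact (hc'.pow 2).continuousOn.integrableOn_compact isCompact_Icc

theorem memLp_wave_xt (hT : 0 ≤ T) :
    MemLp (D.accelXT - timeInt D.derivX) 2 (volume.restrict (rect T)) :=
  D.memLp_accelXT.sub (D.memLp_timeInt_derivX hT)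

theorem abs_toFun_fst_le (x : ℝ) : |D.toFun (x, 0)| ≤ |D.c| + ∫ y, |D.g y| := by
  have e : D.toFun (x, 0) = D.c + ∫ y in (0 : ℝ)..x, D.g y := by simp [toFun]
  rw [e]
  exact (abs_add_le _ _).trans (add_le_add_right (abs_intervalIntegral_le D.integrable_g _ _) _)

theorem abs_toFun_snd_le (t : ℝ) : |D.toFun (0, t)| ≤ |D.c| + ∫ s, |D.h s| := by
  have e : D.toFun (0, t) = D.c + ∫ y in (0 : ℝ)..t, D.h y := by simp [toFun]
  rw [e]
  exact (abs_add_le _ _).trans (add_le_add_right (abs_intervalIntegral_le D.integrable_h _ _) _)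

theorem sq_integral_abs_g_le : (∫ x, |D.g x|) ^ 2 ≤ ∫ x, D.g x ^ 2 := by
  simpa using sq_integral_abs_le zero_le_one D.g_off D.integrable_g D.integrable_g_sq

theorem sq_integral_abs_h_le (hT : 0 ≤ T) : (∫ x, |D.h x|) ^ 2 ≤ T * ∫ x, D.h x ^ 2 :=
  sq_integral_abs_le hT D.h_off D.integrable_h D.integrable_h_sq

/-- The two-point problem gives u_xtt(0,0) = -c/2 - I, where I integrates 1 - y against the
primitive of g and |I| ≤ ∫|g|. Hence c² = 4(u_xtt(0,0) + I)², and the factor 8 comes from (a+b)² ≤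
2a² + 2b². -/
theorem c_sq_le : D.c ^ 2 ≤ 8 * (D.accelX (0, 0) ^ 2 + ∫ x, D.g x ^ 2) := by
  have hG := D.integrable_g.continuous_primitive 0
  have e : D.accelX (0, 0)
      = -(D.c / 2) - ∫ y in (0 : ℝ)..1, (1 - y) * ∫ z in (0 : ℝ)..y, D.g z := by
    have e1 : ∀ y, (1 - y) * D.toFun (y, 0)
        = (1 - y) * D.c + (1 - y) * ∫ z in (0 : ℝ)..y, D.g z := fun y => by
      simp [toFun]
      ring
    have e2 : ∫ y in (0 : ℝ)..1, (1 - y) * D.c = D.c / 2 := by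
      rw [intervalIntegral.integral_mul_const, intervalIntegral.integral_sub (by simp) (by simp)]
      simp
      ring
    simp only [accelX, e1]
    rw [intervalIntegral.integral_add (Continuous.intervalIntegrable (by fun_prop) _ _)
      (Continuous.intervalIntegrable (by fun_prop) _ _), e2]
    simp
    ring
  have b := intervalIntegral.norm_integral_le_of_norm_le_const (a := 0) (b := 1)
    (f := fun y => (1 - y) * ∫ z in (0 : ℝ)..y, D.g z) (C := ∫ x, |D.g x|) fun y hy => by
      rw [uIoc_of_le zero_le_one] at hy
      rw [norm_mul]
      exact (mul_le_of_le_one_left (abs_nonneg _) (abs_one_sub_le y (Ioc_subset_Icc_self hy))).trans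
        (abs_intervalIntegral_le D.integrable_g _ _)
  simp only [Real.norm_eq_abs, sub_zero, abs_one, mul_one] at b
  have b2 := sq_le_sq' (abs_le.1 b).1 (abs_le.1 b).2
  have b3 := D.sq_integral_abs_g_le
  set I := ∫ y in (0 : ℝ)..1, (1 - y) * ∫ z in (0 : ℝ)..y, D.g z
  have : D.c = -(2 * (D.accelX (0, 0) + I)) := by linarith
  rw [this]
  nlinarith [sq_nonneg (D.accelX (0, 0) - I)]

theorem integral_wave_t_le (hT : 0 ≤ T) :
    ∫ t in (0 : ℝ)..T, (-timeInt D.toFun (0, t)) ^ 2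
      ≤ 2 * T ^ 3 * (D.c ^ 2 + T * ∫ x, D.h x ^ 2) := by
  refine (intervalIntegral_le_mul_of_nonneg (C := 2 * T ^ 2 * (D.c ^ 2 + T * ∫ x, D.h x ^ 2)) hT
    (fun t _ => sq_nonneg _) fun t ht => ?_).trans_eq (by ring)
  have b := intervalIntegral.norm_integral_le_of_norm_le_const (a := 0) (b := t)
    (f := fun s => D.toFun (0, s)) fun s _ => D.abs_toFun_snd_le s
  rw [sub_zero, abs_of_nonneg ht.1, mul_comm] at b
  have n : 0 ≤ |D.c| + ∫ s, |D.h s| := (abs_nonneg _).trans (D.abs_toFun_snd_le 0)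
  have b2 : |timeInt D.toFun (0, t)| ≤ T * (|D.c| + ∫ s, |D.h s|) :=
    b.trans (mul_le_mul_of_nonneg_right ht.2 n)
  have b3 := D.sq_integral_abs_h_le hT
  have b4 := pow_le_pow_left₀ (abs_nonneg _) b2 2
  rw [sq_abs, mul_pow] at b4
  rw [neg_sq]
  refine b4.trans ?_
  rw [mul_comm 2 (T ^ 2), mul_assoc]
  refine mul_le_mul_of_nonneg_left ?_ (sq_nonneg T)
  nlinarith [sq_nonneg (|D.c| - ∫ s, |D.h s|), sq_abs D.c]

theorem integral_wave_x_le : ∫ x in (0 : ℝ)..1, D.accelX (x, 0) ^ 2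
    ≤ 3 * (D.accelX (0, 0) ^ 2 + D.c ^ 2 + ∫ x, D.g x ^ 2) := by
  refine (intervalIntegral_le_mul_of_nonneg
    (C := 3 * (D.accelX (0, 0) ^ 2 + D.c ^ 2 + ∫ x, D.g x ^ 2)) zero_le_one
    (fun t _ => sq_nonneg _) fun x hx => ?_).trans_eq (by ring)
  have e : D.accelX (x, 0) = D.accelX (0, 0) + ∫ y in (0 : ℝ)..x, D.toFun (y, 0) := by
    simp only [accelX, intervalIntegral.integral_same]
    ring
  have b := intervalIntegral.norm_integral_le_of_norm_le_const (a := 0) (b := x)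
    (f := fun s => D.toFun (s, 0)) fun s _ => D.abs_toFun_fst_le s
  have n : 0 ≤ |D.c| + ∫ s, |D.g s| := (abs_nonneg _).trans (D.abs_toFun_fst_le 0)
  rw [sub_zero, abs_of_nonneg hx.1] at b
  have b2 := b.trans (mul_le_of_le_one_right n hx.2)
  have b3 := D.sq_integral_abs_g_le
  have b4 := pow_le_pow_left₀ (abs_nonneg _) b2 2
  rw [Real.norm_eq_abs, sq_abs] at b4
  rw [e]
  set I := ∫ y in (0 : ℝ)..x, D.toFun (y, 0)
  set J := ∫ y, |D.g y|
  have b5 : |I| ≤ |D.c| + J := b2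
  have b6 : |D.accelX (0, 0) + I| ≤ |D.accelX (0, 0)| + |D.c| + J :=
    (abs_add_le _ _).trans (by linarith)
  have b7 := pow_le_pow_left₀ (abs_nonneg _) b6 2
  rw [sq_abs] at b7
  nlinarith [sq_nonneg (|D.accelX (0, 0)| - |D.c|), sq_nonneg (|D.accelX (0, 0)| - J),
    sq_nonneg (|D.c| - J), sq_abs D.c, sq_abs (D.accelX (0, 0))]

/-- After (a-b)² ≤ 2a² + 2b², the 8 is 2·2² from |`accelXT`| ≤ 2 `boundT`, and 2T³ is 2T² from the
time primitive times the length T. -/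
theorem integral_wave_xt_le (hT : 0 ≤ T) :
    ∫ x in (0 : ℝ)..1, ∫ t in (0 : ℝ)..T, (D.accelXT - timeInt D.derivX) (x, t) ^ 2
      ≤ 8 * (∫ s, D.boundT s ^ 2) + 2 * T ^ 3 * ∫ y, D.boundX y ^ 2 := by
  have iT := D.integrable_boundT_sq
  have iX := D.integrable_boundX_sq hT
  have inner : ∀ x ∈ Icc (0 : ℝ) 1,
      ∫ t in (0 : ℝ)..T, (D.accelXT - timeInt D.derivX) (x, t) ^ 2
        ≤ 8 * (∫ s, D.boundT s ^ 2) + 2 * T ^ 3 * D.boundX x ^ 2 := by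
    intro x hx
    have h := intervalIntegral_le_of_nonneg hT
      (f := fun t => (D.accelXT - timeInt D.derivX) (x, t) ^ 2)
      (g := fun t => 8 * D.boundT t ^ 2 + 2 * T ^ 2 * D.boundX x ^ 2)
      (fun t _ => sq_nonneg _) ((iT.const_mul 8).intervalIntegrable.add (by simp)) fun t ht => by
        have b1 := pow_le_pow_left₀ (abs_nonneg _) (D.abs_accelXT_le (p := (x, t)) hx) 2
        have b2 := pow_le_pow_left₀ (abs_nonneg _) (D.abs_timeInt_derivX_le (p := (x, t)) ht) 2
        rw [sq_abs] at b1 b2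
        simp only [Pi.sub_apply] at *
        nlinarith [sq_nonneg (D.accelXT (x, t) + timeInt D.derivX (x, t))]
    refine h.trans ?_
    rw [intervalIntegral.integral_add (iT.const_mul 8).intervalIntegrable (by simp),
      intervalIntegral.integral_const_mul, intervalIntegral.integral_const]
    have := intervalIntegral_le_integral hT iT fun s => sq_nonneg _
    simp only [smul_eq_mul, sub_zero]
    nlinarith
  refine (intervalIntegral_le_of_nonneg zero_le_one
    (fun x _ => intervalIntegral.integral_nonneg hT fun t _ => sq_nonneg _)
    (IntervalIntegrable.add (by simp) (iX.const_mul (2 * T ^ 3)).intervalIntegrable)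
    inner).trans ?_
  rw [intervalIntegral.integral_add (by simp) (iX.const_mul (2 * T ^ 3)).intervalIntegrable,
    intervalIntegral.integral_const, intervalIntegral.integral_const_mul]
  have := mul_le_mul_of_nonneg_left
    (intervalIntegral_le_integral (zero_le_one (α := ℝ)) iX fun s => sq_nonneg _)
    (show 0 ≤ 2 * T ^ 3 by positivity)
  simp only [smul_eq_mul, sub_zero, one_mul]
  linarith

theorem innerWHat_wave_le (hT : 0 < T) {v : ℝ × ℝ → ℝ}
    (hv : HasDensities T v 0 (fun x => D.accelX (x, 0)) (fun s => -timeInt D.toFun (0, s))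
      (D.accelXT - timeInt D.derivX)) :
    innerWHat T v v ≤ (50 + 20 * T ^ 3 + 6 * T ^ 4) *
      ((∫ t, D.h t ^ 2) + (D.accelX (0, 0) ^ 2 + ∫ x, D.g x ^ 2) + ∫ p, D.k p ^ 2) := by
  rw [hv.innerWHat_self hT D.memLp_accelX_zero D.memLp_wave_t (D.memLp_wave_xt hT.le)]
  have t1 := D.integral_wave_t_le hT.le
  have t2 := D.integral_wave_x_le
  have t3 := D.integral_wave_xt_le hT.le
  have t4 := D.integral_boundT_sq_le
  have t5 := mul_le_mul_of_nonneg_left (D.integral_boundX_sq_le hT.le)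
    (show 0 ≤ 2 * T ^ 3 by positivity)
  have t6 := D.c_sq_le
  have t7 := mul_le_mul_of_nonneg_left t6 (show 0 ≤ 2 * T ^ 3 by positivity)
  have hH : 0 ≤ ∫ t, D.h t ^ 2 := integral_nonneg fun _ => sq_nonneg _
  have hG : 0 ≤ ∫ x, D.g x ^ 2 := integral_nonneg fun _ => sq_nonneg _
  have hK : 0 ≤ ∫ p, D.k p ^ 2 := integral_nonneg fun _ => sq_nonneg _
  set H := ∫ t, D.h t ^ 2
  set G := ∫ x, D.g x ^ 2
  set K := ∫ p, D.k p ^ 2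
  set B := D.accelX (0, 0) ^ 2 with hB
  have hB0 : 0 ≤ B := sq_nonneg _
  have p3 : 0 ≤ T ^ 3 := by positivity
  have p4 : 0 ≤ T ^ 4 := by positivity
  have q1 := mul_nonneg p3 hH
  have q2 := mul_nonneg p3 hG
  have q3 := mul_nonneg p3 hK
  have q4 := mul_nonneg p3 hB0
  have r1 := mul_nonneg p4 hH
  have r2 := mul_nonneg p4 hG
  have r3 := mul_nonneg p4 hK
  have r4 := mul_nonneg p4 hB0
  -- With c² ≤ 8(B+G) the three parts are at most 16T³(B+G) + 2T⁴H, 27(B+G), and 16H + 16K + 4T³G +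
  -- 4T⁴K. The constant 50 + 20T³ + 6T⁴ exceeds each total coefficient; it is not optimized.
  have e1 : T ^ 3 * (T * H) = T ^ 4 * H := by ring
  have e2 : T ^ 3 * (T * K) = T ^ 4 * K := by ring
  ring_nf at *
  linarith

end L2Densities

/-! ### The wave operator as a bounded linear map. -/

theorem waveOp_hasDensities {T : ℝ} (hT : 0 ≤ T) {u : ℝ × ℝ → ℝ} (D : L2Densities T)
    (h2 : ∀ p ∈ rect T, dt T (dt T u) p = D.accel p)
    (h0 : ∀ p ∈ rect T, u p = timeInt (timeInt D.accel) p) :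
    HasDensities T (waveOp T u) 0 (fun x => D.accelX (x, 0)) (fun s => -timeInt D.toFun (0, s))
      (D.accelXT - timeInt D.derivX) := by
  have H := D.hasDensities_wave hT
  refine ⟨H.1, H.2, H.3, fun x hx t ht => ?_⟩
  have hp : (x, t) ∈ rect T := ⟨hx, ht⟩
  rw [← H.eq_on x hx t ht, waveOp, indicator_of_mem hp, h2 _ hp, (dx_dx_of_eq_timeInt D h0).2 _ hp,
    Pi.sub_apply]

theorem MemW.waveOp_mem {T : ℝ} (hT : 0 ≤ T) {u : ℝ × ℝ → ℝ} (hu : MemW T u) :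
    MemWHat T (waveOp T u) := by
  obtain ⟨D, h2, h0⟩ := hu.exists_densities
  exact ⟨fun p hp => indicator_of_notMem hp _, _, _, _, _, waveOp_hasDensities hT D h2 h0,
    D.memLp_accelX_zero, D.memLp_wave_t, D.memLp_wave_xt hT⟩

theorem waveOp_comb {T : ℝ} (hT : 0 < T) {u v : ℝ × ℝ → ℝ} (hu : MemW T u) (hv : MemW T v)
    (a b : ℝ) : waveOp T (a • u + b • v) = a • waveOp T u + b • waveOp T v := by
  ext p
  by_cases hp : p ∈ rect T
  · have e1 := (dt_congr (dt_comb hT hu.diff_t hv.diff_t a b) p hp).trans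
      (dt_comb hT hu.diff_tt hv.diff_tt a b p hp)
    have e2 := (dx_congr (dx_comb hu.diffX.1 hv.diffX.1 a b) p hp).trans
      (dx_comb hu.diffX.2 hv.diffX.2 a b p hp)
    simp only [waveOp, indicator_of_mem hp, Pi.add_apply, Pi.smul_apply, smul_eq_mul] at *
    rw [e1, e2]
    ring
  · simp [waveOp, hp]

/-- The wave operator as a linear map `W(Ω) → Ŵ(Ω)`. -/
def waveLinearMap (T : ℝ) (hT : 0 < T) : W T hT →ₗ[ℝ] WHat T where
  toFun u := ⟨waveOp T u, MemW.waveOp_mem hT.le u.2⟩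
  map_add' u v := Subtype.ext (by simpa using waveOp_comb hT u.2 v.2 1 1)
  map_smul' a u := Subtype.ext (by simpa using waveOp_comb hT u.2 u.2 a 0)

theorem MemW.normWHat_waveOp_le {T : ℝ} (hT : 0 < T) {u : ℝ × ℝ → ℝ} (hu : MemW T u) :
    normWHat T (waveOp T u) ≤ √(50 + 20 * T ^ 3 + 6 * T ^ 4) * normW T u := by
  obtain ⟨D, h2, h0⟩ := hu.exists_densities
  have hC : 0 ≤ 50 + 20 * T ^ 3 + 6 * T ^ 4 := by positivity
  rw [normWHat, normW, ← Real.sqrt_mul hC]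
  exact Real.sqrt_le_sqrt ((D.innerWHat_wave_le hT (waveOp_hasDensities hT.le D h2 h0)).trans
    (mul_le_mul_of_nonneg_left (D.le_innerW hT h2 h0) hC))

end SineGordon

end

theorem lemma3p1 (T : ℝ) (hT : 0 < T) :
    (∀ u ∈ SineGordon.W T hT,
      SineGordon.DiffX T u ∧ SineGordon.DiffX T (SineGordon.dx u) ∧
      SineGordon.DiffT T u ∧ SineGordon.DiffT T (SineGordon.dt T u)) ∧
    ∃ L : SineGordon.W T hT →ₗ[ℝ] SineGordon.WHat T,
      (∀ u, (L u : ℝ × ℝ → ℝ) = SineGordon.waveOp T (u : ℝ × ℝ → ℝ)) ∧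
      ∃ C : ℝ, ∀ u, SineGordon.normWHat T (L u : ℝ × ℝ → ℝ)
        ≤ C * SineGordon.normW T (u : ℝ × ℝ → ℝ) := by
  refine ⟨fun u hu => ?_, SineGordon.waveLinearMap T hT, fun u => rfl,
    √(50 + 20 * T ^ 3 + 6 * T ^ 4), fun u => SineGordon.MemW.normWHat_waveOp_le hT u.2⟩
  have hu' : SineGordon.MemW T u := hu
  exact ⟨hu'.diffX.1, hu'.diffX.2, hu'.diff_t, hu'.diff_tt⟩
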